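/- **Setting.** For an angle $\theta\in\mathbb T_{2\pi}=\mathbb R/2\pi\mathbb Z$ put $\mathbf u(\theta)=(\cos\theta,\sin\theta)$ and $\mathbf u'(\theta)=(-\sin\theta,\cos\theta)$. For $p>0$ and $x_1,x_2\in\mathbb T_p=\mathbb R/p\mathbb Z$, let $\eta_p(x_1,x_2)$ be the number $y\in[0,p)$ with $x_1+y\equiv x_2 \pmod p$, and let $[x_1,x_2]\subset\mathbb T_p$ be the arc run through in the positive direction from $x_1$ to $x_2$. Let $C\subset\mathbb R^2$ be a convex body, that is, a bounded convex set with non-empty interior. Let $\boldsymbol\Gamma_C\colon\mathbb T_{|\partial C|}\to\mathbb R^2$ be the counterclockwise arc-length parameterization of $\partial C$ (with any base point). Define the set of normals at $s\in\mathbb T_{|\partial C|}$ by $$\nu_C(s)=\Big\{\theta\in\mathbb T_{2\pi}\colon \inf_{\mathbf a\in C}\mathbf a\cdot\mathbf u(\theta)=\boldsymbol\Gamma_C(s)\cdot\mathbf u(\theta)\Big\},$$ and, for $I\subset\mathbb T_{2\pi}$, the portion of perimeter $$P_C(I)=\big|\{s\in\mathbb T_{|\partial C|}\colon \nu_C(s)\cap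 I\neq\varnothing\}\big|.$$ For $\lambda>0$ let $$K_C(\theta,\lambda)=\Big\{\mathbf x\in C\colon \mathbf x\cdot\mathbf u(\theta)=\inf_{\mathbf y\in C}\mathbf y\cdot\mathbf u(\theta)+\lambda\Big\}$$ and write $|\cdot|$ for the length of a chord or of a part of it. For small $\lambda>0$ let $s_C^-(\theta,\lambda),s_C^+(\theta,\lambda)\in\mathbb T_{|\partial C|}$ be the parameters of the two end points of $K_C(\theta,\lambda)$, named so that $$\boldsymbol\Gamma_C(s_C^-(\theta,\lambda))-\boldsymbol\Gamma_C(s_C^+(\theta,\lambda))=|K_C(\theta,\lambda)|\,\mathbf u'(\theta).$$ Put $$s_C^{o^\pm}(\theta)=\lim_{\lambda\to0^+}s_C^\pm(\theta,\lambda),\qquad s_C^o(\theta)=s_C^{o^-}(\theta)+\tfrac12\,\eta_{|\partial C|}\big(s_C^{o^-}(\theta),s_C^{o^+}(\theta)\big).$$ The right semi-chord $K_C^+(\theta,\lambda)$ is the projection, in direction $\mathbf u(\theta)$, of the boundary arc $\boldsymbol\Gamma_C([s_C^o(\theta),s_C^+(\theta,\lambda)])$ on the chord $K_C(\theta,\lambda)$,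 that is, the set of all $\mathbf x\in K_C(\theta,\lambda)$ for which the line $\mathbf x+\mathbb R\,\mathbf u(\theta)$ meets that arc. **Proposition.** Let $C\subset\mathbb R^2$ be a convex body and let $I=(\alpha,\beta]\subset\mathbb T_{2\pi}$ be a left semi-open interval of angles, where $\alpha<\beta\le\alpha+2\pi$. Then $\theta\mapsto|K_C^+(\theta,\lambda)|^2$ is integrable on $I$ for all sufficiently small $\lambda>0$, and $$\lim_{\lambda\to0^+}\frac1{2\lambda}\int_I\big|K_C^+(\theta,\lambda)\big|^2\,d\theta=P_C(I).$$ -/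

import Mathlib

open Set Filter Topology MeasureTheory

noncomputable section

namespace PlanarConvex

/-- The Euclidean plane. -/
abbrev Plane : Type := EuclideanSpace ℝ (Fin 2)

/-- The unit vector `u(θ) = (cos θ, sin θ)`, for an angle `θ ∈ ℝ / 2πℤ`. -/
def u (θ : Real.Angle) : Plane := !₂[θ.cos, θ.sin]

/-- The derivative `u'(θ) = (-sin θ, cos θ)`. -/
def u' (θ : Real.Angle) : Plane := !₂[-θ.sin, θ.cos]

/-- Length (one-dimensional Hausdorff measure) of a subset of the plane. -/
def length (A : Set Plane) : ℝ := (μH[1] A).toReal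

/-- The value `inf_{y ∈ C} y · u(θ)`. -/
def infHeight (C : Set Plane) (θ : Real.Angle) : ℝ :=
  sInf ((fun y : Plane => inner ℝ y (u θ)) '' C)

/-- The chord `K_C(θ, lam)` of `C` in direction `u(θ)` at distance `lam`. -/
def chord (C : Set Plane) (θ : Real.Angle) (lam : ℝ) : Set Plane :=
  {x | x ∈ C ∧ inner ℝ x (u θ) = infHeight C θ + lam}

/-- The ordered distance `η_p(x, y)` on `ℝ / pℤ` (for `p > 0`): the number in `[0, p)` which has
to be added to `x` in order to get `y`, that is, the least such number which is `≥ 0`. -/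
def orderedDist {p : ℝ} (x y : AddCircle p) : ℝ :=
  sInf {t : ℝ | 0 ≤ t ∧ x + (t : AddCircle p) = y}

/-- The arc `[x, y]` of `ℝ / pℤ`, run through in the positive direction from `x` to `y`. -/
def posArc {p : ℝ} (x y : AddCircle p) : Set (AddCircle p) :=
  {z | orderedDist x z ≤ orderedDist x y}

/-- `Γ : ℝ / Lℤ → ℝ²` is a (counterclockwise, simple) arc-length parameterization of the boundary
of `C`; in particular `L` is the perimeter of `C`. The parameterization is unique up to the choice
of the base point `Γ 0`. -/
structure IsBoundaryParam (C : Set Plane) {L : ℝ} (Γ : AddCircle L → Plane) : Prop where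
  injective : Function.Injective Γ
  range_eq : range Γ = frontier C
  /-- Every arc of the curve with parameter interval `[a, b]` has length `b - a`. -/
  unitSpeed : HasUnitSpeedOn (fun t : ℝ => Γ (t : AddCircle L)) univ
  /-- The curve winds once, in the counterclockwise sense, around an interior point `c` of `C`:
  there is a continuous choice `φ` of the polar angle about `c`, and it grows by `2π` in a turn. -/
  counterclockwise : ∃ c ∈ interior C, ∃ φ : ℝ → ℝ, Continuous φ ∧
    (∀ t, φ (t + L) = φ t + 2 * Real.pi) ∧
    ∀ t : ℝ, ∃ r : ℝ, 0 < r ∧ Γ (t : AddCircle L) = c + r • u (φ t : Real.Angle)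

theorem lipschitz_u : LipschitzWith 2 (fun t : ℝ => u (t : Real.Angle)) := by
  refine LipschitzWith.of_dist_le_mul fun a b => ?_
  have hc := Real.lipschitzWith_cos.dist_le_mul a b
  have hs := Real.lipschitzWith_sin.dist_le_mul a b
  rw [NNReal.coe_one, one_mul, Real.dist_eq, Real.dist_eq] at hc hs
  rw [EuclideanSpace.dist_eq, Real.dist_eq]
  apply Real.sqrt_le_iff.2
  refine ⟨by positivity, ?_⟩
  simp only [u, Fin.sum_univ_two, Real.dist_eq, Real.Angle.cos_coe, Real.Angle.sin_coe]
  simp only [Matrix.cons_val_zero, Matrix.cons_val_one, NNReal.coe_ofNat]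
  nlinarith [abs_nonneg (a - b), abs_nonneg (Real.cos a - Real.cos b),
    abs_nonneg (Real.sin a - Real.sin b)]

theorem norm_u (θ : Real.Angle) : ‖u θ‖ = 1 := by
  rw [EuclideanSpace.norm_eq]
  simp [u, Fin.sum_univ_two, Real.Angle.cos_sq_add_sin_sq]

theorem u_injective : Function.Injective u := by
  intro a b h
  induction a using Real.Angle.induction_on with
  | _ a =>
  induction b using Real.Angle.induction_on with
  | _ b =>
  have h0 := congrArg (fun x : Plane => x 0) h
  have h1 := congrArg (fun x : Plane => x 1) h
  simp [u] at h0 h1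
  exact Real.Angle.cos_sin_inj h0 h1

theorem exists_eq_norm_smul_u (x : Plane) : ∃ t : ℝ, x = ‖x‖ • u (t : Real.Angle) := by
  refine ⟨Complex.arg ⟨x 0, x 1⟩, ?_⟩
  have hn : ‖(⟨x 0, x 1⟩ : ℂ)‖ = ‖x‖ := by
    rw [EuclideanSpace.norm_eq, Complex.norm_def, Complex.normSq_apply, Fin.sum_univ_two]
    simp [pow_two]
  have hc := Complex.norm_mul_cos_arg (⟨x 0, x 1⟩ : ℂ)
  have hs := Complex.norm_mul_sin_arg (⟨x 0, x 1⟩ : ℂ)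
  rw [hn] at hc hs
  ext i
  fin_cases i
  · simpa [u] using hc.symm
  · simpa [u] using hs.symm

/-- The boundary of a convex body in polar coordinates about an interior point. -/
theorem exists_polar (C : Set Plane) (hconv : Convex ℝ C) (hbdd : Bornology.IsBounded C)
    (hint : (interior C).Nonempty) :
    ∃ c ∈ interior C, ∃ ρ : ℝ → ℝ, (∀ t, 0 < ρ t) ∧ (∀ t, ρ (t + 2 * Real.pi) = ρ t) ∧
      range (fun t : ℝ => c + ρ t • u (t : Real.Angle)) = frontier C ∧
      ∃ K, LipschitzWith K (fun t : ℝ => c + ρ t • u (t : Real.Angle)) := by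
  obtain ⟨c, hc⟩ := hint
  set S : Set Plane := (fun x => c + x) ⁻¹' C with hS
  have hSconv : Convex ℝ S := hconv.translate_preimage_right c
  have hS0 : S ∈ 𝓝 (0 : Plane) := by
    refine (continuous_const_add c).continuousAt.preimage_mem_nhds ?_
    simpa using mem_interior_iff_mem_nhds.1 hc
  have hSb : Bornology.IsBounded S := by
    have : S = (fun x => -c + x) '' C := by
      rw [hS, ← Homeomorph.coe_addLeft c, ← Homeomorph.coe_addLeft (-c)]
      ext x
      simp only [mem_preimage, mem_image, Homeomorph.coe_addLeft]
      exact ⟨fun h => ⟨c + x, h, by simp⟩, by rintro ⟨y, hy, rfl⟩; simpa using hy⟩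
    rw [this]
    exact (LipschitzWith.isBounded_image (K := 1)
      (LipschitzWith.of_dist_le_mul (by simp)) hbdd)
  have hSf : ∀ x, c + x ∈ frontier C ↔ gauge S x = 1 := by
    intro x
    rw [gauge_eq_one_iff_mem_frontier hSconv hS0, hS]
    have := (Homeomorph.addLeft c).preimage_frontier C
    rw [Homeomorph.coe_addLeft] at this
    rw [← this]; rfl
  have hpos : ∀ x : Plane, 0 < gauge S x ↔ x ≠ 0 := fun x =>
    gauge_pos (absorbent_nhds_zero hS0) (NormedSpace.isVonNBounded_of_isBounded ℝ hSb)
  set g : ℝ → ℝ := fun t => gauge S (u (t : Real.Angle)) with hg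
  have hgpos : ∀ t, 0 < g t := fun t => (hpos _).2 fun h => by
    have := norm_u (t : Real.Angle); rw [h] at this; simp at this
  obtain ⟨R, hR0, hR⟩ := hSb.subset_ball_lt 0 0
  have hglow : ∀ t, R⁻¹ ≤ g t := by
    intro t
    have := gauge_mono (absorbent_nhds_zero hS0) hR (u (t : Real.Angle))
    rwa [gauge_ball hR0.le, norm_u, one_div] at this
  have hrlow : ∀ t, (g t)⁻¹ ≤ R := fun t => inv_le_of_inv_le₀ hR0 (hglow t)
  obtain ⟨K, hK⟩ := hSconv.lipschitz_gauge hS0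
  have hgK : LipschitzWith (K * 2) g := hK.comp lipschitz_u
  have hper : ∀ t : ℝ, ((t + 2 * Real.pi : ℝ) : Real.Angle) = (t : Real.Angle) := by
    intro t; simp
  refine ⟨c, hc, fun t => (g t)⁻¹, fun t => inv_pos.2 (hgpos t), ?_, ?_, ?_⟩
  · intro t; simp only [hg, hper]
  · ext x
    constructor
    · rintro ⟨t, rfl⟩
      rw [hSf, gauge_smul_of_nonneg (inv_nonneg.2 (hgpos t).le), smul_eq_mul]
      exact inv_mul_cancel₀ (hgpos t).ne'
    · intro hx
      obtain ⟨t, ht⟩ := exists_eq_norm_smul_u (x - c)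
      have h1 : gauge S (x - c) = 1 := by rw [← hSf]; simpa using hx
      rw [ht, gauge_smul_of_nonneg (norm_nonneg _), smul_eq_mul] at h1
      refine ⟨t, ?_⟩
      have h2 : (g t)⁻¹ = ‖x - c‖ := inv_eq_of_mul_eq_one_left h1
      simp only [h2, ← ht]
      simp
  · refine ⟨(R * R * (K * 2) + 2 * R).toNNReal, LipschitzWith.of_dist_le_mul fun a b => ?_⟩
    have h1 : |(g a)⁻¹ - (g b)⁻¹| ≤ R * R * (K * 2) * |a - b| := by
      rw [inv_sub_inv (hgpos a).ne' (hgpos b).ne', abs_div, div_eq_mul_inv, abs_mul, mul_inv,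
        abs_of_pos (hgpos a), abs_of_pos (hgpos b), mul_comm]
      have h3 := hgK.dist_le_mul b a
      rw [Real.dist_eq, Real.dist_eq, abs_sub_comm b a] at h3
      have h4 : (g a)⁻¹ * (g b)⁻¹ ≤ R * R :=
        mul_le_mul (hrlow a) (hrlow b) (inv_nonneg.2 (hgpos b).le) hR0.le
      calc _ ≤ (R * R) * (((K * 2 : NNReal) : ℝ) * |a - b|) :=
            mul_le_mul h4 h3 (abs_nonneg _) (by positivity)
        _ = _ := by push_cast; ring
    have h2 := lipschitz_u.dist_le_mul a b
    rw [Real.dist_eq, dist_eq_norm] at h2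
    rw [dist_add_left, dist_eq_norm, Real.dist_eq]
    have h5 : (g a)⁻¹ • u (a : Real.Angle) - (g b)⁻¹ • u (b : Real.Angle) =
        ((g a)⁻¹ - (g b)⁻¹) • u (a : Real.Angle) +
          (g b)⁻¹ • (u (a : Real.Angle) - u (b : Real.Angle)) := by
      rw [sub_smul, smul_sub]; abel
    rw [h5]
    refine (norm_add_le _ _).trans ?_
    rw [norm_smul, norm_smul, norm_u, mul_one, Real.norm_eq_abs, Real.norm_eq_abs,
      abs_of_pos (inv_pos.2 (hgpos b))]
    have h6 : (g b)⁻¹ * ‖u (a : Real.Angle) - u (b : Real.Angle)‖ ≤ R * (2 * |a - b|) :=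
      mul_le_mul (hrlow b) (by simpa using h2) (norm_nonneg _) hR0.le
    calc _ ≤ R * R * (K * 2) * |a - b| + R * (2 * |a - b|) := add_le_add h1 h6
      _ = _ := by rw [Real.coe_toNNReal _ (by positivity)]; ring

/-- The boundary of a convex body has a counterclockwise arc-length parameterization. -/
theorem exists_isBoundaryParam (C : Set Plane) (hconv : Convex ℝ C)
    (hbdd : Bornology.IsBounded C) (hint : (interior C).Nonempty) :
    ∃ (L : ℝ) (_ : Fact (0 < L)) (Γ : AddCircle L → Plane), IsBoundaryParam C Γ := by
  obtain ⟨c, hc, ρ, hρ, hρper, hrange, K, hK⟩ := exists_polar C hconv hbdd hint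
  set q : ℝ → Plane := fun t : ℝ => c + ρ t • u (t : Real.Angle) with hq
  have hLB : LocallyBoundedVariationOn q univ := hK.locallyBoundedVariationOn univ
  have hqinj : ∀ a b, q a = q b → (a : Real.Angle) = (b : Real.Angle) := by
    intro a b hab
    have h1 : ρ a • u (a : Real.Angle) = ρ b • u (b : Real.Angle) := add_left_cancel hab
    have h2 := congrArg norm h1
    rw [norm_smul, norm_smul, norm_u, norm_u, mul_one, mul_one, Real.norm_eq_abs,
      Real.norm_eq_abs, abs_of_pos (hρ a), abs_of_pos (hρ b)] at h2
    rw [h2] at h1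
    exact u_injective (smul_right_injective _ (hρ b).ne' h1)
  have hqper : ∀ t, q (t + 2 * Real.pi) = q t := by
    intro t; simp [hq, hρper]
  set V : ℝ → ℝ := variationOnFromTo q univ 0 with hV
  have hVadd : ∀ a b, V b - V a = variationOnFromTo q univ a b := fun a b =>
    variationOnFromTo.sub_right hLB (mem_univ _) (mem_univ _) (mem_univ _)
  have hmono : StrictMono V := by
    intro a b hab
    rcases (variationOnFromTo.nonneg_of_le q univ hab.le).lt_or_eq with h | h
    · rw [← hVadd] at h; linarith
    · exfalso
      have h1 := (variationOnFromTo.eq_zero_iff_of_le hLB (mem_univ a) (mem_univ b) hab.le).1 h.symm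
      set d := min b (a + 1) with hd
      have had : a < d := lt_min hab (by linarith)
      have h2 := h1 (x := a) ⟨mem_univ _, le_rfl, hab.le⟩ (y := d)
        ⟨mem_univ _, had.le, min_le_left _ _⟩
      have h3 := hqinj _ _ (edist_eq_zero.1 h2)
      obtain ⟨k, hk⟩ := Real.Angle.angle_eq_iff_two_pi_dvd_sub.1 h3.symm
      have h4 : d - a ≤ 1 := by linarith [min_le_right b (a + 1)]
      have h5 : 0 < d - a := by linarith
      rw [hk] at h4 h5
      have hk0 : (0 : ℝ) < k := by
        by_contra hcon
        have := mul_nonpos_of_nonneg_of_nonpos (by positivity : (0:ℝ) ≤ 2 * Real.pi)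
          (not_lt.1 hcon)
        linarith
      have hk1 : (1 : ℝ) ≤ k := by exact_mod_cast (by exact_mod_cast hk0 : (0 : ℤ) < k)
      nlinarith [Real.pi_gt_three]
  have hVle : ∀ a b, a ≤ b → V b - V a ≤ K * (b - a) := by
    intro a b hab
    rw [hVadd, variationOnFromTo.eq_of_le _ _ hab]
    refine ENNReal.toReal_le_of_le_ofReal
      (mul_nonneg K.coe_nonneg (sub_nonneg.2 hab)) ?_
    have h1 := (hK.lipschitzOnWith (s := univ)).comp_eVariationOn_le
      (g := (id : ℝ → ℝ)) (s := univ ∩ Icc a b) (mapsTo_univ _ _)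
    refine h1.trans ?_
    have h2 : eVariationOn (id : ℝ → ℝ) (univ ∩ Icc a b) ≤ ENNReal.ofReal (id b - id a) :=
      ((monotone_id.monotoneOn _).eVariationOn_eq (mem_univ _) (mem_univ _)).le
    rw [ENNReal.ofReal_mul K.coe_nonneg, ENNReal.ofReal_coe_nnreal]
    gcongr
    exact h2
  have hVlip : LipschitzWith K V := by
    refine LipschitzWith.of_dist_le_mul fun a b => ?_
    rw [Real.dist_eq, Real.dist_eq]
    rcases le_total a b with h | h
    · rw [abs_sub_comm, abs_sub_comm a b, abs_of_nonneg (sub_nonneg.2 (hmono.monotone h)),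
        abs_of_nonneg (sub_nonneg.2 h)]
      exact hVle a b h
    · rw [abs_of_nonneg (sub_nonneg.2 (hmono.monotone h)), abs_of_nonneg (sub_nonneg.2 h)]
      exact hVle b a h
  have hV0 : V 0 = 0 := variationOnFromTo.self _ _ _
  set L : ℝ := V (2 * Real.pi) with hL
  have hLpos : 0 < L := by rw [← hV0]; exact hmono (by positivity)
  have hshift : ∀ a b, variationOnFromTo q univ (a + 2 * Real.pi) (b + 2 * Real.pi) =
      variationOnFromTo q univ a b := by
    intro a b
    have h1 := variationOnFromTo.comp_eq_of_monotoneOn (t := univ) q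
      (fun x : ℝ => x + 2 * Real.pi)
      (fun x _ y _ hxy => by simpa using hxy) (mem_univ a) (mem_univ b)
    have h2 : (fun x : ℝ => x + 2 * Real.pi) '' univ = univ := by
      rw [image_univ]; exact (add_right_surjective _).range_eq
    have h3 : q ∘ (fun x : ℝ => x + 2 * Real.pi) = q := funext hqper
    rw [h2, h3] at h1
    exact h1.symm
  have hVper : ∀ t, V (t + 2 * Real.pi) = V t + L := by
    intro t
    have h1 := hshift 0 t
    rw [zero_add, ← hVadd, ← hVadd, hV0, ← hL] at h1
    linarith
  have hVn : ∀ n : ℕ, V (n * (2 * Real.pi)) = n * L := by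
    intro n
    induction n with
    | zero => simp [hV0]
    | succ n ih => push_cast; rw [add_mul, one_mul, hVper, ih]; ring
  have hVz : ∀ n : ℤ, ∀ t, V (t + n * (2 * Real.pi)) = V t + n * L := by
    intro n
    induction n using Int.induction_on with
    | zero => simp
    | succ n ih =>
      intro t
      push_cast at ih ⊢
      rw [add_mul, one_mul, ← add_assoc, hVper, ih]; ring
    | pred n ih =>
      intro t
      have h1 := hVper (t + (-(n : ℝ) - 1) * (2 * Real.pi))
      have h2 := ih t
      push_cast at h2 ⊢
      have h3 : t + (-(n : ℝ) - 1) * (2 * Real.pi) + 2 * Real.pi =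
        t + -(n : ℝ) * (2 * Real.pi) := by ring
      rw [h3, h2] at h1
      linarith
  have hsurj : Function.Surjective V := by
    intro y
    obtain ⟨n, hn⟩ := exists_nat_ge (|y| / L)
    rw [div_le_iff₀ hLpos] at hn
    have hb := abs_le.1 hn
    have h1 := hVz (-(n : ℤ)) 0
    have h2 := hVn n
    rw [zero_add, hV0] at h1
    push_cast at h1
    obtain ⟨x, -, hx⟩ := intermediate_value_Icc
      (a := -(n : ℝ) * (2 * Real.pi)) (b := n * (2 * Real.pi))
      (by nlinarith [Real.pi_pos, (Nat.cast_nonneg n : (0 : ℝ) ≤ n)])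
      hVlip.continuous.continuousOn
      (show y ∈ Icc _ _ by rw [h1, h2]; constructor <;> linarith [hb.1, hb.2])
    exact ⟨x, hx⟩
  set e : ℝ ≃o ℝ := hmono.orderIsoOfSurjective V hsurj with he
  have heV : ∀ t, e t = V t := fun t => rfl
  have hsymm : ∀ t (n : ℤ), e.symm (t + n * L) = e.symm t + n * (2 * Real.pi) := by
    intro t n
    rw [OrderIso.symm_apply_eq, heV, hVz, ← heV, e.apply_symm_apply]
  set G : ℝ → Plane := fun t => q (e.symm t) with hG
  have hqz : ∀ (n : ℤ) t, q (t + n * (2 * Real.pi)) = q t := fun n t =>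
    (show Function.Periodic q (2 * Real.pi) from hqper).int_mul n t
  have hGper : Function.Periodic G L := by
    intro t
    have h1 := hsymm t 1
    have h2 := hqz 1 (e.symm t)
    simp only [Int.cast_one, one_mul] at h1 h2
    simp only [hG, h1, h2]
  have hGnat : G = naturalParameterization q univ 0 := by
    funext t
    have h1 := edist_naturalParameterization_eq_zero hLB (mem_univ (0 : ℝ)) (mem_univ (e.symm t))
    have h2 : variationOnFromTo q univ 0 (e.symm t) = t := e.apply_symm_apply t
    rw [h2] at h1
    exact (edist_eq_zero.1 h1).symm
  refine ⟨L, ⟨hLpos⟩, hGper.lift, ?_, ?_, ?_, c, hc, e.symm, e.symm.continuous, ?_, ?_⟩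
  · intro x y
    induction x using QuotientAddGroup.induction_on with
    | H x =>
    induction y using QuotientAddGroup.induction_on with
    | H y =>
    intro hxy
    rw [Function.Periodic.lift_coe, Function.Periodic.lift_coe] at hxy
    obtain ⟨k, hk⟩ := Real.Angle.angle_eq_iff_two_pi_dvd_sub.1 (hqinj _ _ hxy)
    have h1 : e.symm x = e.symm y + k * (2 * Real.pi) := by linarith
    rw [← hsymm, e.symm.injective.eq_iff] at h1
    rw [h1]
    have h2 := (AddCircle.coe_eq_zero_iff L (x := (k : ℝ) * L)).2 ⟨k, by simp⟩
    change ((y + k * L : ℝ) : AddCircle L) = (y : AddCircle L)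
    rw [AddCircle.coe_add, h2, add_zero]
  · rw [← hrange]
    ext x
    constructor
    · rintro ⟨s, rfl⟩
      induction s using QuotientAddGroup.induction_on with
      | H s => exact ⟨e.symm s, rfl⟩
    · rintro ⟨t, rfl⟩
      refine ⟨((e t : ℝ) : AddCircle L), ?_⟩
      change G (e t) = q t
      simp only [hG, e.symm_apply_apply]
  · have h1 := has_unit_speed_naturalParameterization q hLB (mem_univ (0 : ℝ))
    have h2 : variationOnFromTo q univ 0 '' univ = univ := by
      rw [image_univ]; exact hsurj.range_eq
    rw [h2, ← hGnat] at h1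
    exact h1
  · intro t
    have h1 := hsymm t 1
    simpa using h1
  · intro t
    exact ⟨ρ (e.symm t), hρ _, rfl⟩

section Curve

variable (C : Set Plane) {L : ℝ} (Γ : AddCircle L → Plane)

/-- The set of (inner) normals `ν_C(s)` at the boundary point `Γ s`. -/
def normals (s : AddCircle L) : Set Real.Angle :=
  {θ | infHeight C θ = inner ℝ (Γ s) (u θ)}

/-- The portion of perimeter `P_C(I)`: the measure of the set of all parameters `s ∈ ℝ / Lℤ` such
that `ν_C(s)` meets `I`. -/
def perimeterPortion [Fact (0 < L)] (I : Set Real.Angle) : ℝ :=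
  (volume {s : AddCircle L | (normals C Γ s ∩ I).Nonempty}).toReal

/-- `p = (s⁻, s⁺)` are the parameters of the end points of the chord `K_C(θ, lam)`, in the order
given by `Γ(s⁻) - Γ(s⁺) = |K_C(θ, lam)| u'(θ)`. (End points of the closure of the chord, since `C`
is not assumed to be closed.) -/
def IsChordEnds (θ : Real.Angle) (lam : ℝ) (p : AddCircle L × AddCircle L) : Prop :=
  Γ p.1 ∈ extremePoints ℝ (closure (chord C θ lam)) ∧
  Γ p.2 ∈ extremePoints ℝ (closure (chord C θ lam)) ∧
  Γ p.1 - Γ p.2 = length (chord C θ lam) • u' θ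

open Classical in
/-- The parameters `(s⁻_C(θ, lam), s⁺_C(θ, lam))` of the end points of the chord (and a junk value
when there are none, which does not happen when `lam` is positive and less than the width of `C` in
direction `u(θ)`). -/
def chordEnds (θ : Real.Angle) (lam : ℝ) : AddCircle L × AddCircle L :=
  if h : ∃ p, IsChordEnds C Γ θ lam p then h.choose else (0, 0)

/-- `s⁻_C(θ, lam)`. -/
def sMinus (θ : Real.Angle) (lam : ℝ) : AddCircle L := (chordEnds C Γ θ lam).1

/-- `s⁺_C(θ, lam)`. -/
def sPlus (θ : Real.Angle) (lam : ℝ) : AddCircle L := (chordEnds C Γ θ lam).2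

/-- The limit of `s⁻_C(θ, lam)` as `lam → 0⁺`. -/
def sMinusZero (θ : Real.Angle) : AddCircle L := limUnder (𝓝[>] (0 : ℝ)) (sMinus C Γ θ)

/-- The limit of `s⁺_C(θ, lam)` as `lam → 0⁺`. -/
def sPlusZero (θ : Real.Angle) : AddCircle L := limUnder (𝓝[>] (0 : ℝ)) (sPlus C Γ θ)

/-- The midpoint `s^o_C(θ)` of the arc between the two previous limits. -/
def sZero (θ : Real.Angle) : AddCircle L :=
  sMinusZero C Γ θ +
    ((orderedDist (sMinusZero C Γ θ) (sPlusZero C Γ θ) / 2 : ℝ) : AddCircle L)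

/-- The right semi-chord `K⁺_C(θ, lam)`: the projection, in direction `u(θ)`, of the boundary arc
`Γ([s^o_C(θ), s⁺_C(θ, lam)])` on the chord `K_C(θ, lam)`. -/
def rightSemiChord (θ : Real.Angle) (lam : ℝ) : Set Plane :=
  {x | x ∈ chord C θ lam ∧ ∃ s ∈ posArc (sZero C Γ θ) (sPlus C Γ θ lam),
    ∃ t : ℝ, Γ s = x + t • u θ}

end Curve

end PlanarConvex

end

noncomputable section

namespace PlanarConvex

/-! ### Heights and offsets -/

/-! Write h(θ) for `infHeight C θ`. It is Lipschitz, hence differentiable for almost every θ, and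
for such θ the supporting line with inner normal u(θ) touches the closure of C in a single point.
Heights are measured from that line and offsets from the contact point, positive in the direction
-u'(θ). The identity that drives the proof is ∂/∂θ height(a, θ) = -offset(a, θ)
(`hasDerivAt_height`).

Let M(θ, λ) be the `reach`, the largest offset among points of height at most λ. The length of the
right semi-chord lies between M - Kλ and M (`exists_length_bounds`), so it suffices to treat the
integral of M². For almost every θ, M²/2 is the integral of y dy over (0, M]. Pulled back along the
boundary curve, it becomes the integral over t of the `kernel`: offset times tangential speed on the
part of the boundary that lies to the right of the contact point, faces down and has height at most
λ (`integral_kernel`).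

Fubini then allows the boundary point Γ(t) to be fixed while θ varies. For almost every t the curve
has a unit tangent at t, and Γ(t) has exactly one normal ϑ modulo 2π. The tangential speed is cos(θ
- ϑ). On the quarter-turn before ϑ the height of Γ(t) decreases to 0, and the offset is minus its
derivative, so integrating the offset over the angles where the height is at most λ gives exactly λ,
once λ is small (`exists_integral_cutOffset_eq`). As λ → 0 these angles shrink to ϑ from the left
and the cosine tends to 1. Hence 1/λ times the angular integral of the kernel tends to 1 if I
contains ϑ modulo 2π, and to 0 otherwise (`tendsto_integral_kernel`). The one-sided concentration is
why I is open on the left and closed on the right. Dominated convergence over t yields the perimeter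
portion. -/

theorem inner_u (a : Plane) (θ : ℝ) :
    inner ℝ a (u (θ : Real.Angle)) = a 0 * Real.cos θ + a 1 * Real.sin θ := by
  simp [u, PiLp.inner_apply, Fin.sum_univ_two, mul_comm]

theorem inner_u' (a : Plane) (θ : ℝ) :
    inner ℝ a (u' (θ : Real.Angle)) = -(a 0 * Real.sin θ) + a 1 * Real.cos θ := by
  simp [u', PiLp.inner_apply, Fin.sum_univ_two, mul_comm]

theorem hasDerivAt_inner_u (a : Plane) (θ : ℝ) :
    HasDerivAt (fun θ : ℝ => inner ℝ a (u (θ : Real.Angle)))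
      (inner ℝ a (u' (θ : Real.Angle))) θ := by
  simp only [inner_u, inner_u']
  exact (((Real.hasDerivAt_cos θ).const_mul (a 0)).add
    ((Real.hasDerivAt_sin θ).const_mul (a 1))).congr_deriv (by ring)

theorem sq_inner_add_sq_inner (a : Plane) (θ : ℝ) :
    inner ℝ a (u (θ : Real.Angle)) ^ 2 + inner ℝ a (u' (θ : Real.Angle)) ^ 2 = ‖a‖ ^ 2 := by
  rw [inner_u, inner_u', EuclideanSpace.norm_eq, Real.sq_sqrt (by positivity)]
  simp only [Fin.sum_univ_two, Real.norm_eq_abs, sq_abs]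
  linear_combination (a 0 ^ 2 + a 1 ^ 2) * Real.sin_sq_add_cos_sq θ

theorem abs_inner_u_le (a : Plane) (θ : ℝ) : |inner ℝ a (u (θ : Real.Angle))| ≤ ‖a‖ := by
  refine abs_le_of_sq_le_sq ?_ (norm_nonneg a)
  nlinarith [sq_inner_add_sq_inner a θ, sq_nonneg (inner ℝ a (u' (θ : Real.Angle)))]

theorem abs_inner_u'_le (a : Plane) (θ : ℝ) : |inner ℝ a (u' (θ : Real.Angle))| ≤ ‖a‖ := by
  refine abs_le_of_sq_le_sq ?_ (norm_nonneg a)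
  nlinarith [sq_inner_add_sq_inner a θ, sq_nonneg (inner ℝ a (u (θ : Real.Angle)))]

theorem norm_le_abs_add_abs (a : Plane) (θ : ℝ) :
    ‖a‖ ≤ |inner ℝ a (u (θ : Real.Angle))| + |inner ℝ a (u' (θ : Real.Angle))| := by
  refine le_of_sq_le_sq ?_ (by positivity)
  rw [← sq_inner_add_sq_inner a θ, add_sq, sq_abs, sq_abs]
  nlinarith [mul_nonneg (abs_nonneg (inner ℝ a (u (θ : Real.Angle))))
    (abs_nonneg (inner ℝ a (u' (θ : Real.Angle))))]

theorem eq_of_inner_eq {a b : Plane} (θ : ℝ)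
    (h : inner ℝ a (u (θ : Real.Angle)) = inner ℝ b (u (θ : Real.Angle)))
    (h' : inner ℝ a (u' (θ : Real.Angle)) = inner ℝ b (u' (θ : Real.Angle))) : a = b := by
  have := norm_le_abs_add_abs (a - b) θ
  rw [inner_sub_left, inner_sub_left, h, h'] at this
  simpa [sub_eq_zero] using this

theorem inner_smul_add_smul_u (x y θ : ℝ) :
    inner ℝ (x • u (θ : Real.Angle) + y • u' (θ : Real.Angle)) (u (θ : Real.Angle)) = x := by
  rw [inner_u]
  simp only [u, u', PiLp.add_apply, PiLp.smul_apply, smul_eq_mul, Real.Angle.cos_coe,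
    Real.Angle.sin_coe]
  simp only [Matrix.cons_val_zero, Matrix.cons_val_one]
  linear_combination x * Real.sin_sq_add_cos_sq θ

theorem inner_smul_add_smul_u' (x y θ : ℝ) :
    inner ℝ (x • u (θ : Real.Angle) + y • u' (θ : Real.Angle)) (u' (θ : Real.Angle)) = y := by
  rw [inner_u']
  simp only [u, u', PiLp.add_apply, PiLp.smul_apply, smul_eq_mul, Real.Angle.cos_coe,
    Real.Angle.sin_coe]
  simp only [Matrix.cons_val_zero, Matrix.cons_val_one]
  linear_combination y * Real.sin_sq_add_cos_sq θ

theorem continuous_u : Continuous fun θ : ℝ => u (θ : Real.Angle) := lipschitz_u.continuous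

theorem continuous_u' : Continuous fun θ : ℝ => u' (θ : Real.Angle) := by
  simp only [u', Real.Angle.cos_coe, Real.Angle.sin_coe]
  refine (PiLp.continuous_toLp 2 _).comp (continuous_pi fun i => ?_)
  fin_cases i
  · exact Real.continuous_sin.neg
  · exact Real.continuous_cos

/-- The height of `a` above the supporting line of `C` with inner normal `u(θ)`. -/
def height (C : Set Plane) (a : Plane) (θ : ℝ) : ℝ :=
  inner ℝ a (u (θ : Real.Angle)) - infHeight C θ

/-- The coordinate of `a` in direction `-u'(θ)`. If `C` touches its supporting line with inner
normal `u(θ)` in only one point, then this is the coordinate relative to that point. -/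
def offset (C : Set Plane) (a : Plane) (θ : ℝ) : ℝ :=
  deriv (fun t : ℝ => infHeight C t) θ - inner ℝ a (u' (θ : Real.Angle))

/-- A convex body which need not be closed. -/
structure IsBody (C : Set Plane) : Prop where
  convex : Convex ℝ C
  bounded : Bornology.IsBounded C
  interior_nonempty : (interior C).Nonempty

variable {C : Set Plane}

namespace IsBody

theorem isCompact_closure (hC : IsBody C) : IsCompact (closure C) := hC.bounded.isCompact_closure

theorem nonempty (hC : IsBody C) : C.Nonempty := hC.interior_nonempty.mono interior_subset

theorem bddBelow (hC : IsBody C) (θ : ℝ) :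
    BddBelow ((fun y : Plane => inner ℝ y (u (θ : Real.Angle))) '' C) := by
  obtain ⟨R, hR⟩ := hC.bounded.exists_norm_le
  refine ⟨-R, ?_⟩
  rintro _ ⟨a, ha, rfl⟩
  linarith [(abs_le.1 (abs_inner_u_le a θ)).1, hR a ha]

theorem height_nonneg (hC : IsBody C) {a : Plane} (ha : a ∈ closure C) (θ : ℝ) :
    0 ≤ height C a θ := by
  have : closure C ⊆ {a | 0 ≤ height C a θ} := by
    refine closure_minimal (fun a ha => ?_) ?_
    · exact sub_nonneg.2 (csInf_le (hC.bddBelow θ) ⟨a, ha, rfl⟩)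
    · exact isClosed_le continuous_const
        ((continuous_id.inner continuous_const).sub continuous_const)
  exact this ha

theorem infHeight_le (hC : IsBody C) {a : Plane} (ha : a ∈ closure C) (θ : ℝ) :
    infHeight C θ ≤ inner ℝ a (u (θ : Real.Angle)) := sub_nonneg.1 (hC.height_nonneg ha θ)

theorem exists_height_eq_zero (hC : IsBody C) (θ : ℝ) : ∃ a ∈ closure C, height C a θ = 0 := by
  obtain ⟨a, ha, hmin⟩ := hC.isCompact_closure.exists_isMinOn hC.nonempty.closure
    (f := fun y : Plane => inner ℝ y (u (θ : Real.Angle)))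
    (continuous_id.inner continuous_const).continuousOn
  refine ⟨a, ha, le_antisymm (sub_nonpos.2 ?_) (hC.height_nonneg ha θ)⟩
  refine le_csInf (hC.nonempty.image _) ?_
  rintro _ ⟨b, hb, rfl⟩
  exact hmin (subset_closure hb)

/-- An infimum of the functions θ ↦ a · u(θ), which are uniformly Lipschitz because C is bounded.
Differentiability almost everywhere follows, and no finer regularity of the support function is
needed. -/
theorem exists_lipschitz (hC : IsBody C) :
    ∃ K, LipschitzWith K (fun θ : ℝ => infHeight C θ) := by
  obtain ⟨R, hR⟩ := hC.isCompact_closure.isBounded.exists_norm_le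
  have key : ∀ θ θ' : ℝ, infHeight C θ - infHeight C θ' ≤ R * 2 * dist θ θ' := by
    intro θ θ'
    obtain ⟨a, ha, ha0⟩ := hC.exists_height_eq_zero θ'
    have h1 := hC.infHeight_le ha θ
    have h2 : inner ℝ a (u (θ : Real.Angle) - u (θ' : Real.Angle)) ≤ R * 2 * dist θ θ' := by
      refine (real_inner_le_norm _ _).trans ?_
      have h3 := lipschitz_u.dist_le_mul θ θ'
      rw [dist_eq_norm] at h3
      have := mul_le_mul (hR a ha) h3 (norm_nonneg _) ((norm_nonneg _).trans (hR a ha))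
      simpa [mul_assoc] using this
    rw [inner_sub_right] at h2
    unfold height at ha0
    linarith
  have hR0 : 0 ≤ R := by
    obtain ⟨a, ha⟩ := hC.nonempty
    exact (norm_nonneg _).trans (hR a (subset_closure ha))
  refine ⟨(R * 2).toNNReal, LipschitzWith.of_dist_le_mul fun θ θ' => ?_⟩
  rw [Real.coe_toNNReal _ (by positivity), Real.dist_eq, abs_le]
  have := key θ' θ
  rw [dist_comm] at this
  exact ⟨by linarith, key θ θ'⟩

theorem continuous_infHeight (hC : IsBody C) : Continuous fun θ : ℝ => infHeight C θ :=
  hC.exists_lipschitz.choose_spec.continuous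

theorem ae_differentiableAt (hC : IsBody C) :
    ∀ᵐ θ : ℝ, DifferentiableAt ℝ (fun t : ℝ => infHeight C t) θ :=
  hC.exists_lipschitz.choose_spec.ae_differentiableAt

theorem continuous_height (hC : IsBody C) :
    Continuous fun p : Plane × ℝ => height C p.1 p.2 :=
  (continuous_fst.inner (continuous_u.comp continuous_snd)).sub
    (hC.continuous_infHeight.comp continuous_snd)

/-- The sign of `offset` is chosen to suit this identity: offsets, which are lengths along chords,
integrate in the angle to differences of heights. -/
theorem hasDerivAt_height {a : Plane} {θ : ℝ}
    (h : DifferentiableAt ℝ (fun t : ℝ => infHeight C t) θ) :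
    HasDerivAt (height C a) (-offset C a θ) θ := by
  unfold offset
  rw [neg_sub]
  exact (hasDerivAt_inner_u a θ).sub h.hasDerivAt

/-- The nonnegative function `height C a` has a minimum at θ, so its derivative vanishes. Height and
offset determine a point, so the contact point is unique wherever the support function is
differentiable. -/
theorem offset_eq_zero (hC : IsBody C) {a : Plane} {θ : ℝ}
    (h : DifferentiableAt ℝ (fun t : ℝ => infHeight C t) θ) (ha : a ∈ closure C)
    (h0 : height C a θ = 0) : offset C a θ = 0 := by
  have h1 : IsLocalMin (height C a) θ :=
    Eventually.of_forall fun t => by rw [h0]; exact hC.height_nonneg ha t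
  simpa using h1.hasDerivAt_eq_zero (hasDerivAt_height h)

theorem exists_lt_height (hC : IsBody C) {a : Plane} (ha : a ∈ interior C) :
    ∃ ρ > 0, ∀ θ : ℝ, ρ < height C a θ := by
  obtain ⟨ε, hε, hb⟩ := Metric.mem_nhds_iff.1 (mem_interior_iff_mem_nhds.1 ha)
  refine ⟨ε / 4, by positivity, fun θ => ?_⟩
  have h1 : a - (ε / 2) • u (θ : Real.Angle) ∈ C := by
    refine hb ?_
    rw [Metric.mem_ball, dist_eq_norm, sub_sub_cancel_left, norm_neg, norm_smul, norm_u,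
      Real.norm_eq_abs, abs_of_pos (by positivity)]
    linarith
  have h2 := hC.height_nonneg (subset_closure h1) θ
  have h3 : inner ℝ (u (θ : Real.Angle)) (u (θ : Real.Angle)) = (1 : ℝ) := by
    rw [real_inner_self_eq_norm_sq, norm_u]; norm_num
  unfold height at h2 ⊢
  rw [inner_sub_left, inner_smul_left, h3] at h2
  simp at h2
  linarith

theorem height_pos (hC : IsBody C) {a : Plane} (ha : a ∈ interior C) (θ : ℝ) :
    0 < height C a θ := by
  obtain ⟨ρ, hρ, h⟩ := hC.exists_lt_height ha
  exact hρ.trans (h θ)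

theorem _root_.PlanarConvex.mem_frontier_of_forall_not_mem {a v : Plane} (ha : a ∈ closure C)
    (h : ∀ t : ℝ, 0 < t → a + t • v ∉ closure C) : a ∈ frontier C := by
  refine ⟨ha, fun hi => ?_⟩
  have h1 : Tendsto (fun t : ℝ => a + t • v) (𝓝[>] 0) (𝓝 a) := by
    have : Continuous fun t : ℝ => a + t • v := by fun_prop
    simpa using (this.tendsto 0).mono_left nhdsWithin_le_nhds
  have h2 := (h1.eventually (isOpen_interior.mem_nhds hi)).and self_mem_nhdsWithin
  obtain ⟨t, ht, ht0⟩ := h2.exists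
  exact h t ht0 (subset_closure (interior_subset ht))

theorem frontier_of_height_eq_zero (hC : IsBody C) {a : Plane} {θ : ℝ} (ha : a ∈ closure C)
    (h : height C a θ = 0) : a ∈ frontier C :=
  ⟨ha, fun hi => (hC.height_pos hi θ).ne' h⟩

/-- Hahn–Banach separates a from the open convex interior. The functional is the inner product with
some v, and θ is the polar angle of -v. -/
theorem exists_normal (hC : IsBody C) {a : Plane} (ha : a ∈ frontier C) :
    ∃ θ : ℝ, height C a θ = 0 := by
  obtain ⟨f, hf⟩ := geometric_hahn_banach_open_point hC.convex.interior isOpen_interior ha.2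
  obtain ⟨v, hv⟩ := (InnerProductSpace.toDual ℝ Plane).surjective f
  have hfv : ∀ x, f x = inner ℝ v x := fun x => by
    rw [← hv, InnerProductSpace.toDual_apply_apply]
  obtain ⟨t, ht⟩ := exists_eq_norm_smul_u (-v)
  have hle : ∀ b ∈ closure C, f b ≤ f a := by
    rw [← hC.convex.closure_interior_eq_closure_of_nonempty_interior hC.interior_nonempty]
    intro b hb
    exact closure_minimal (fun b hb => (hf b hb).le)
      (isClosed_le f.continuous continuous_const) hb
  have hv0 : 0 < ‖-v‖ := by
    rw [norm_pos_iff]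
    intro h0
    obtain ⟨b, hb⟩ := hC.interior_nonempty
    have := hf b hb
    rw [hfv, hfv, neg_eq_zero.1 h0] at this
    simp at this
  obtain ⟨b, hb, hb0⟩ := hC.exists_height_eq_zero t
  refine ⟨t, le_antisymm ?_ (hC.height_nonneg ha.1 t)⟩
  have h1 := hle b hb
  rw [hfv, hfv, ← neg_le_neg_iff, ← inner_neg_left, ← inner_neg_left, ht, inner_smul_left,
    inner_smul_left] at h1
  simp only [conj_trivial] at h1
  have h2 := le_of_mul_le_mul_left h1 hv0
  rw [real_inner_comm, real_inner_comm b] at h2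
  unfold height at hb0 ⊢
  linarith

/-- The bound covers every angle: where the support function is not differentiable, `deriv` is 0. -/
theorem exists_offset_bound (hC : IsBody C) :
    ∃ D : ℝ, 0 < D ∧ ∀ a ∈ closure C, ∀ θ : ℝ, |offset C a θ| ≤ D := by
  obtain ⟨R, hR⟩ := hC.isCompact_closure.isBounded.exists_norm_le
  obtain ⟨K, hK⟩ := hC.exists_lipschitz
  refine ⟨K + |R| + 1, by positivity, fun a ha θ => ?_⟩
  have h1 : |deriv (fun t : ℝ => infHeight C t) θ| ≤ K := norm_deriv_le_of_lipschitz hK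
  have h2 := (abs_inner_u'_le a θ).trans ((hR a ha).trans (le_abs_self R))
  unfold offset
  exact (abs_sub _ _).trans (by linarith)

end IsBody

/-! ### Monotonicity of the height on the quarter-turns next to a normal -/

theorem height_add_two_pi (a : Plane) (θ : ℝ) : height C a (θ + 2 * Real.pi) = height C a θ := by
  simp [height]

theorem inner_u_sub (a : Plane) (θ ψ : ℝ) :
    inner ℝ a (u ((θ - ψ : ℝ) : Real.Angle)) = inner ℝ a (u (θ : Real.Angle)) * Real.cos ψ -
      inner ℝ a (u' (θ : Real.Angle)) * Real.sin ψ := by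
  simp only [inner_u, inner_u', Real.cos_sub, Real.sin_sub]
  ring

namespace IsBody

/-- For t₂ ≤ t₁ ≤ θ compare a with a contact point b at t₁. With a - b = A u(θ) + B u'(θ), the
height of a at t₁ equals A cos(θ - t₁) - B sin(θ - t₁), the height at t₂ is at least the same
expression in t₂, and A ≤ 0. If B ≤ 0, both terms grow from t₁ to t₂; if B ≥ 0, the height at t₁ is
at most 0. -/
theorem antitoneOn_height (hC : IsBody C) {a : Plane} {θ : ℝ} (ha : a ∈ closure C)
    (h : height C a θ = 0) : AntitoneOn (height C a) (Icc (θ - Real.pi / 2) θ) := by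
  intro t₂ h₂ t₁ h₁ h21
  obtain ⟨b, hb, hb0⟩ := hC.exists_height_eq_zero t₁
  have hbθ := hC.height_nonneg hb θ
  have hb2 := hC.height_nonneg hb t₂
  have ha2 := hC.height_nonneg ha t₂
  have e₁ := inner_u_sub (a - b) θ (θ - t₁)
  have e₂ := inner_u_sub (a - b) θ (θ - t₂)
  rw [sub_sub_cancel, inner_sub_left, inner_sub_left a b, inner_sub_left a b] at e₁ e₂
  unfold height at *
  have hc : Real.cos (θ - t₂) ≤ Real.cos (θ - t₁) :=
    Real.cos_le_cos_of_nonneg_of_le_pi (by linarith [h₁.2])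
      (by linarith [h₂.1, Real.pi_pos]) (by linarith)
  have hs : Real.sin (θ - t₁) ≤ Real.sin (θ - t₂) :=
    Real.sin_le_sin_of_le_of_le_pi_div_two (by linarith [h₁.2, Real.pi_pos])
      (by linarith [h₂.1]) (by linarith)
  have hs1 : 0 ≤ Real.sin (θ - t₁) :=
    Real.sin_nonneg_of_nonneg_of_le_pi (by linarith [h₁.2]) (by linarith [h₁.1, Real.pi_pos])
  have hc1 : 0 ≤ Real.cos (θ - t₁) :=
    Real.cos_nonneg_of_neg_pi_div_two_le_of_le (by linarith [h₁.2, Real.pi_pos])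
      (by linarith [h₁.1])
  set A := inner ℝ a (u (θ : Real.Angle)) - inner ℝ b (u (θ : Real.Angle)) with hA
  set B := inner ℝ a (u' (θ : Real.Angle)) - inner ℝ b (u' (θ : Real.Angle)) with hB
  have hA0 : A ≤ 0 := by linarith
  rcases le_total B 0 with hB0 | hB0
  · nlinarith [mul_le_mul_of_nonpos_left hc hA0, mul_le_mul_of_nonpos_left hs hB0]
  · nlinarith [mul_nonneg hB0 hs1, mul_nonpos_of_nonpos_of_nonneg hA0 hc1]

theorem monotoneOn_height (hC : IsBody C) {a : Plane} {θ : ℝ} (ha : a ∈ closure C)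
    (h : height C a θ = 0) : MonotoneOn (height C a) (Icc θ (θ + Real.pi / 2)) := by
  intro t₁ h₁ t₂ h₂ h21
  obtain ⟨b, hb, hb0⟩ := hC.exists_height_eq_zero t₁
  have hbθ := hC.height_nonneg hb θ
  have hb2 := hC.height_nonneg hb t₂
  have ha2 := hC.height_nonneg ha t₂
  have e₁ := inner_u_sub (a - b) θ (θ - t₁)
  have e₂ := inner_u_sub (a - b) θ (θ - t₂)
  rw [sub_sub_cancel, inner_sub_left, inner_sub_left a b, inner_sub_left a b, ← neg_sub t₁ θ,
    Real.cos_neg, Real.sin_neg] at e₁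
  rw [sub_sub_cancel, inner_sub_left, inner_sub_left a b, inner_sub_left a b, ← neg_sub t₂ θ,
    Real.cos_neg, Real.sin_neg] at e₂
  unfold height at *
  have hc : Real.cos (t₂ - θ) ≤ Real.cos (t₁ - θ) :=
    Real.cos_le_cos_of_nonneg_of_le_pi (by linarith [h₁.1])
      (by linarith [h₂.2, Real.pi_pos]) (by linarith)
  have hs : Real.sin (t₁ - θ) ≤ Real.sin (t₂ - θ) :=
    Real.sin_le_sin_of_le_of_le_pi_div_two (by linarith [h₁.1, Real.pi_pos])
      (by linarith [h₂.2]) (by linarith)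
  have hs1 : 0 ≤ Real.sin (t₁ - θ) :=
    Real.sin_nonneg_of_nonneg_of_le_pi (by linarith [h₁.1]) (by linarith [h₁.2, Real.pi_pos])
  have hc1 : 0 ≤ Real.cos (t₁ - θ) :=
    Real.cos_nonneg_of_neg_pi_div_two_le_of_le (by linarith [h₁.1, Real.pi_pos])
      (by linarith [h₁.2])
  set A := inner ℝ a (u (θ : Real.Angle)) - inner ℝ b (u (θ : Real.Angle)) with hA
  set B := inner ℝ a (u' (θ : Real.Angle)) - inner ℝ b (u' (θ : Real.Angle)) with hB
  have hA0 : A ≤ 0 := by linarith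
  rcases le_total 0 B with hB0 | hB0
  · nlinarith [mul_le_mul_of_nonpos_left hc hA0, mul_le_mul_of_nonneg_left hs hB0]
  · nlinarith [mul_nonpos_of_nonpos_of_nonneg hB0 hs1,
      mul_nonpos_of_nonpos_of_nonneg hA0 hc1]

theorem offset_nonneg (hC : IsBody C) {a : Plane} {θ t : ℝ} (ha : a ∈ closure C)
    (h : height C a θ = 0) (hd : DifferentiableAt ℝ (fun t : ℝ => infHeight C t) t)
    (ht : t ∈ Ioo (θ - Real.pi / 2) θ) : 0 ≤ offset C a t := by
  have h1 := (hC.antitoneOn_height ha h).derivWithin_nonpos (x := t)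
  rw [derivWithin_of_mem_nhds (Icc_mem_nhds ht.1 ht.2), (hasDerivAt_height hd).deriv] at h1
  linarith

theorem offset_nonpos (hC : IsBody C) {a : Plane} {θ t : ℝ} (ha : a ∈ closure C)
    (h : height C a θ = 0) (hd : DifferentiableAt ℝ (fun t : ℝ => infHeight C t) t)
    (ht : t ∈ Ioo θ (θ + Real.pi / 2)) : offset C a t ≤ 0 := by
  have h1 := (hC.monotoneOn_height ha h).derivWithin_nonneg (x := t)
  rw [derivWithin_of_mem_nhds (Icc_mem_nhds ht.1 ht.2), (hasDerivAt_height hd).deriv] at h1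
  linarith

end IsBody

/-! ### Curves of unit speed -/

section UnitSpeed

variable {γ : ℝ → Plane}

theorem _root_.HasUnitSpeedOn.lipschitzWith (hγ : HasUnitSpeedOn γ univ) : LipschitzWith 1 γ := by
  have key : ∀ a b, a ≤ b → edist (γ a) (γ b) ≤ edist a b := by
    intro a b hab
    have h1 := hγ (mem_univ a) (mem_univ b)
    have h2 := eVariationOn.edist_le γ (s := univ ∩ Icc a b)
      ⟨mem_univ a, le_rfl, hab⟩ ⟨mem_univ b, hab, le_rfl⟩
    rw [h1] at h2
    rw [edist_dist a b, Real.dist_eq, abs_sub_comm, abs_of_nonneg (sub_nonneg.2 hab)]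
    simpa using h2
  intro a b
  rw [ENNReal.coe_one, one_mul]
  rcases le_total a b with h | h
  · exact key a b h
  · rw [edist_comm, edist_comm a b]
    exact key b a h

theorem norm_deriv_le_of_lipschitzWith (hγ : LipschitzWith 1 γ) (t : ℝ) : ‖deriv γ t‖ ≤ 1 := by
  simpa using norm_deriv_le_of_lipschitz (x₀ := t) hγ

theorem intervalIntegrable_norm_deriv (hγ : LipschitzWith 1 γ) (a b : ℝ) :
    IntervalIntegrable (fun t => ‖deriv γ t‖) volume a b := by
  refine (intervalIntegrable_const (c := (1 : ℝ))).mono_fun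
    (measurable_deriv γ).norm.aestronglyMeasurable (Eventually.of_forall fun t => ?_)
  simpa using norm_deriv_le_of_lipschitzWith hγ t

/-- Pairing γ with its own increment w reduces the claim to the fundamental theorem for a real
absolutely continuous function; a factor ‖w‖ is cancelled at the end. -/
theorem norm_sub_le_integral_norm_deriv (hγ : LipschitzWith 1 γ) {a b : ℝ} (hab : a ≤ b) :
    ‖γ b - γ a‖ ≤ ∫ t in a..b, ‖deriv γ t‖ := by
  set w := γ b - γ a with hw
  rcases eq_or_ne w 0 with h0 | h0
  · rw [h0, norm_zero]
    exact intervalIntegral.integral_nonneg hab fun t _ => norm_nonneg _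
  have hlip : LipschitzWith (‖innerSL ℝ w‖₊ * 1) (fun t => innerSL ℝ w (γ t)) :=
    (innerSL ℝ w).lipschitz.comp hγ
  have hac := (hlip.lipschitzOnWith (s := uIcc a b)).absolutelyContinuousOnInterval
  have h1 := hac.integral_deriv_eq_sub
  rw [← map_sub, ← hw, innerSL_apply_apply, real_inner_self_eq_norm_sq] at h1
  have h2 : ∫ t in a..b, deriv (fun t => innerSL ℝ w (γ t)) t ≤ ∫ t in a..b, ‖w‖ * ‖deriv γ t‖ := by
    refine intervalIntegral.integral_mono_ae hab hac.intervalIntegrable_deriv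
      ((intervalIntegrable_norm_deriv hγ a b).const_mul _) ?_
    filter_upwards [hγ.ae_differentiableAt] with t ht
    have := ((innerSL ℝ w).hasFDerivAt.comp_hasDerivAt t ht.hasDerivAt).deriv
    have h3 : deriv (fun t => innerSL ℝ w (γ t)) t = inner ℝ w (deriv γ t) := this
    rw [h3]
    exact real_inner_le_norm _ _
  rw [h1, intervalIntegral.integral_const_mul, pow_two] at h2
  exact le_of_mul_le_mul_left h2 (norm_pos_iff.2 h0)

/-- Increments of γ are dominated by those of the monotone primitive ℓ of ‖γ'‖. So the variation of
γ, which is b - a, is at most that of ℓ, which is the integral. -/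
theorem _root_.HasUnitSpeedOn.integral_norm_deriv (hγ : HasUnitSpeedOn γ univ) {a b : ℝ}
    (hab : a ≤ b) : b - a ≤ ∫ t in a..b, ‖deriv γ t‖ := by
  have hlip := hγ.lipschitzWith
  set ℓ : ℝ → ℝ := fun x => ∫ t in a..x, ‖deriv γ t‖ with hℓ
  have hsub : ∀ x y, ℓ y - ℓ x = ∫ t in x..y, ‖deriv γ t‖ := fun x y =>
    intervalIntegral.integral_interval_sub_left (intervalIntegrable_norm_deriv hlip _ _)
      (intervalIntegrable_norm_deriv hlip _ _)
  have hmono : Monotone ℓ := fun x y hxy => sub_nonneg.1 <| by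
    rw [hsub]; exact intervalIntegral.integral_nonneg hxy fun t _ => norm_nonneg _
  have h1 : eVariationOn γ (univ ∩ Icc a b) ≤ eVariationOn ℓ (univ ∩ Icc a b) := by
    refine iSup_mono fun p => Finset.sum_le_sum fun i _ => ?_
    have hle := p.2.2.1 (Nat.le_succ i)
    rw [edist_dist, edist_dist]
    refine ENNReal.ofReal_le_ofReal ?_
    rw [dist_eq_norm, Real.dist_eq, hsub]
    exact (norm_sub_le_integral_norm_deriv hlip hle).trans (le_abs_self _)
  rw [hγ (mem_univ a) (mem_univ b), (hmono.monotoneOn univ).eVariationOn_eq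
    (mem_univ a) (mem_univ b), NNReal.coe_one, one_mul, hsub] at h1
  exact (ENNReal.ofReal_le_ofReal_iff
    (intervalIntegral.integral_nonneg hab fun t _ => norm_nonneg _)).1 h1

/-- The function 1 - ‖γ'‖ is nonnegative and has nonpositive integral over each interval (-n, n], so
it vanishes almost everywhere. -/
theorem _root_.HasUnitSpeedOn.ae_norm_deriv_eq_one (hγ : HasUnitSpeedOn γ univ) :
    ∀ᵐ t, DifferentiableAt ℝ γ t ∧ ‖deriv γ t‖ = 1 := by
  have hlip := hγ.lipschitzWith
  have h1 : ∀ n : ℕ, ∀ᵐ t, t ∈ Ioc (-(n : ℝ)) n → 1 - ‖deriv γ t‖ = 0 := by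
    intro n
    rw [← ae_restrict_iff' measurableSet_Ioc]
    have hn : -(n : ℝ) ≤ n := by have : (0 : ℝ) ≤ n := Nat.cast_nonneg n; linarith
    have hint := (intervalIntegrable_const (c := (1 : ℝ))).sub
      (intervalIntegrable_norm_deriv hlip (-(n : ℝ)) n)
    refine (setIntegral_eq_zero_iff_of_nonneg_ae (Eventually.of_forall fun t => ?_) hint.1).1 ?_
    · exact sub_nonneg.2 (norm_deriv_le_of_lipschitzWith hlip t)
    · have h2 := intervalIntegral.integral_sub (intervalIntegrable_const (c := (1 : ℝ)))
        (intervalIntegrable_norm_deriv hlip (-(n : ℝ)) n)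
      have h3 := hγ.integral_norm_deriv hn
      rw [intervalIntegral.integral_const, smul_eq_mul, mul_one] at h2
      refine le_antisymm ?_ (setIntegral_nonneg measurableSet_Ioc fun t _ =>
        sub_nonneg.2 (norm_deriv_le_of_lipschitzWith hlip t))
      rw [intervalIntegral.integral_of_le hn] at h2
      exact h2.trans_le (sub_nonpos.2 h3)
  filter_upwards [hlip.ae_differentiableAt, ae_all_iff.2 h1] with t ht h
  refine ⟨ht, ?_⟩
  obtain ⟨n, hn⟩ := exists_nat_gt |t|
  have := h n ⟨(abs_lt.1 hn).1, (abs_lt.1 hn).2.le⟩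
  linarith

end UnitSpeed

/-! ### The boundary curve -/

variable {L : ℝ} {Γ : AddCircle L → Plane}

theorem IsBody.mem_interior_of_ray (hC : IsBody C) {c v : Plane} (hc : c ∈ interior C)
    {r r' : ℝ} (hr : 0 < r) (hrr : r < r') (h : c + r' • v ∈ closure C) :
    c + r • v ∈ interior C := by
  have hr' : 0 < r' := hr.trans hrr
  have h1 := hC.convex.combo_interior_closure_mem_interior hc h
    (a := 1 - r / r') (b := r / r') (by rw [sub_pos, div_lt_one hr']; exact hrr)
    (by positivity) (by ring)
  convert h1 using 1
  rw [smul_add, smul_smul, div_mul_cancel₀ _ hr'.ne', ← add_assoc, ← add_smul]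
  simp

/-- The boundary curve as a periodic function on the line. -/
def curve (Γ : AddCircle L → Plane) (t : ℝ) : Plane := Γ (t : AddCircle L)

namespace IsBoundaryParam

theorem lipschitzWith (hΓ : IsBoundaryParam C Γ) : LipschitzWith 1 (curve Γ) :=
  hΓ.unitSpeed.lipschitzWith

theorem continuous (hΓ : IsBoundaryParam C Γ) : Continuous Γ :=
  continuous_coinduced_dom.2 hΓ.lipschitzWith.continuous

theorem mem_frontier (hΓ : IsBoundaryParam C Γ) (s : AddCircle L) : Γ s ∈ frontier C :=
  hΓ.range_eq ▸ mem_range_self s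

theorem mem_closure (hΓ : IsBoundaryParam C Γ) (s : AddCircle L) : Γ s ∈ closure C :=
  frontier_subset_closure (hΓ.mem_frontier s)

theorem exists_eq (hΓ : IsBoundaryParam C Γ) {a : Plane} (ha : a ∈ frontier C) : ∃ s, Γ s = a := by
  rwa [← hΓ.range_eq] at ha

theorem injOn_curve [hL : Fact (0 < L)] (hΓ : IsBoundaryParam C Γ) (a : ℝ) :
    InjOn (curve Γ) (Ioc a (a + L)) := by
  intro s hs t ht h
  have h1 := hΓ.injective h
  exact (AddCircle.coe_eq_coe_iff_of_mem_Ioc hs ht).1 h1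

theorem exists_mem_Ioc [hL : Fact (0 < L)] (hΓ : IsBoundaryParam C Γ) {a : Plane}
    (ha : a ∈ frontier C) : ∃ t ∈ Ioc 0 L, curve Γ t = a := by
  obtain ⟨s, rfl⟩ := hΓ.exists_eq ha
  obtain ⟨t, ht, rfl⟩ : s ∈ ((↑) : ℝ → AddCircle L) '' Ioc 0 (0 + L) := by
    rw [AddCircle.coe_image_Ioc_eq]; exact mem_univ s
  exact ⟨t, by simpa using ht, rfl⟩

/-- A ray from an interior point meets the frontier only once, so injectivity of Γ makes the
continuous polar angle injective, hence strictly monotone. Its gain of 2π per turn excludes the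
decreasing case. -/
theorem exists_strictMono_angle [hL : Fact (0 < L)] (hΓ : IsBoundaryParam C Γ) (hC : IsBody C) :
    ∃ c ∈ interior C, ∃ φ : ℝ → ℝ, Continuous φ ∧ StrictMono φ ∧
      (∀ t, φ (t + L) = φ t + 2 * Real.pi) ∧
      ∀ t : ℝ, ∃ r : ℝ, 0 < r ∧ curve Γ t = c + r • u (φ t : Real.Angle) := by
  obtain ⟨c, hc, φ, hφ, hper, h⟩ := hΓ.counterclockwise
  refine ⟨c, hc, φ, hφ, ?_, hper, h⟩
  have hperz : ∀ (n : ℤ) t, φ (t + n * L) = φ t + n * (2 * Real.pi) := by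
    -- Subtracting the linear part leaves a periodic function, which extends the shift rule to all
    -- integer multiples of L.
    have hp : Function.Periodic (fun t => φ t - t * (2 * Real.pi / L)) L := by
      intro t
      have : L ≠ 0 := hL.out.ne'
      simp only [hper]
      field_simp
      ring
    intro n t
    have h1 := hp.int_mul n t
    have : L ≠ 0 := hL.out.ne'
    field_simp at h1
    rw [← sub_eq_zero]
    have : L * (φ (t + n * L) - (φ t + n * (2 * Real.pi))) = 0 := by linarith
    exact (mul_eq_zero.1 this).resolve_left hL.out.ne'
  have hinj : Function.Injective φ := by
    intro s t hst
    obtain ⟨r, hr, hs⟩ := h s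
    obtain ⟨r', hr', ht⟩ := h t
    have hrr : r = r' := by
      by_contra hne
      rw [← hst] at ht
      rcases lt_or_gt_of_ne hne with hlt | hlt
      · exact (hΓ.mem_frontier s).2 (hs ▸ hC.mem_interior_of_ray hc hr hlt
          (ht ▸ hΓ.mem_closure t))
      · exact (hΓ.mem_frontier t).2 (ht ▸ hC.mem_interior_of_ray hc hr' hlt
          (hs ▸ hΓ.mem_closure s))
    rw [← hrr, ← hst, ← hs] at ht
    have h1 := hΓ.injective ht
    rw [eq_comm, ← sub_eq_zero, ← AddCircle.coe_sub, AddCircle.coe_eq_zero_iff] at h1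
    obtain ⟨n, hn⟩ := h1
    rw [zsmul_eq_mul] at hn
    have h2 := hperz n t
    rw [show t + n * L = s by linarith, hst] at h2
    have h3 : (n : ℝ) * (2 * Real.pi) = 0 := by linarith
    have h4 : (n : ℝ) = 0 := (mul_eq_zero.1 h3).resolve_right (by positivity)
    rw [h4] at hn
    linarith
  rcases hφ.strictMono_of_inj hinj with hm | hm
  · exact hm
  · have h1 := hm (show (0 : ℝ) < 0 + L by linarith [hL.out])
    rw [hper] at h1
    linarith [Real.pi_pos]

/-- Γ(t) minimizes the height in direction u(θ), so the velocity is κ u'(θ). The increasing polar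
angle makes its component along u'(φ(t)) nonnegative, that is κ cos(θ - φ(t)) ≥ 0, and the cosine is
negative because c lies strictly above the supporting line. Hence κ ≤ 0; this is where the
orientation enters. -/
theorem deriv_curve_eq [hL : Fact (0 < L)] (hΓ : IsBoundaryParam C Γ) (hC : IsBody C) {t θ : ℝ}
    (hd : DifferentiableAt ℝ (curve Γ) t) (h0 : height C (curve Γ t) θ = 0) :
    deriv (curve Γ) t = -(‖deriv (curve Γ) t‖ • u' (θ : Real.Angle)) := by
  obtain ⟨c, hc, φ, hφ, hmono, -, hpol⟩ := hΓ.exists_strictMono_angle hC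
  obtain ⟨r, hr, hrt⟩ := hpol t
  have hperp : inner ℝ (deriv (curve Γ) t) (u (θ : Real.Angle)) = (0 : ℝ) := by
    have hmin : IsLocalMin (fun s => inner ℝ (curve Γ s) (u (θ : Real.Angle))) t :=
      Eventually.of_forall fun s => by
        have h1 := hC.height_nonneg (hΓ.mem_closure s) θ
        unfold height at h1 h0
        change inner ℝ (curve Γ t) (u (θ : Real.Angle)) ≤ inner ℝ (Γ s) (u (θ : Real.Angle))
        linarith
    refine hmin.hasDerivAt_eq_zero ?_
    have := hd.hasDerivAt.inner ℝ (hasDerivAt_const t (u (θ : Real.Angle)))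
    simpa using this
  have hccw : 0 ≤ inner ℝ (deriv (curve Γ) t) (u' (φ t : Real.Angle)) := by
    have h1 : HasDerivAt (fun s => inner ℝ (curve Γ s) (u' (φ t : Real.Angle)))
        (inner ℝ (deriv (curve Γ) t) (u' (φ t : Real.Angle))) t := by
      have := hd.hasDerivAt.inner ℝ (hasDerivAt_const t (u' (φ t : Real.Angle)))
      simpa using this
    have h2 := (hasDerivWithinAt_iff_tendsto_slope' (s := Ioi t) (by simp)).1
      h1.hasDerivWithinAt
    refine ge_of_tendsto h2 ?_
    have h3 : ∀ᶠ s in 𝓝[>] t, φ s < φ t + Real.pi :=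
      (hφ.tendsto t).mono_left nhdsWithin_le_nhds |>.eventually_lt_const
        (by linarith [Real.pi_pos])
    filter_upwards [h3, self_mem_nhdsWithin] with s hs hts
    rw [slope_def_field]
    refine div_nonneg ?_ (sub_nonneg.2 (le_of_lt hts))
    obtain ⟨ρ, hρ, hρs⟩ := hpol s
    rw [hρs, hrt, inner_add_left, inner_add_left, inner_smul_left, inner_smul_left]
    have e1 : inner ℝ (u (φ s : Real.Angle)) (u' (φ t : Real.Angle)) =
        Real.sin (φ s - φ t) := by
      rw [inner_u', Real.sin_sub]; simp [u]; ring
    have e2 : inner ℝ (u (φ t : Real.Angle)) (u' (φ t : Real.Angle)) = (0 : ℝ) := by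
      rw [inner_u']; simp [u]; ring
    rw [e1, e2]
    have := mul_nonneg hρ.le (Real.sin_nonneg_of_nonneg_of_le_pi
      (sub_nonneg.2 (hmono hts).le) (by linarith))
    simpa using this
  have hcos : Real.cos (θ - φ t) < 0 := by
    have h1 := hC.height_pos hc θ
    unfold height at h0 h1
    rw [hrt, inner_add_left, inner_smul_left] at h0
    have e1 : inner ℝ (u (φ t : Real.Angle)) (u (θ : Real.Angle)) = Real.cos (θ - φ t) := by
      rw [inner_u, Real.cos_sub]; simp [u]; ring
    rw [e1] at h0
    simp only [conj_trivial] at h0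
    by_contra hcon
    have := mul_nonneg hr.le (not_lt.1 hcon)
    linarith
  set κ := inner ℝ (deriv (curve Γ) t) (u' (θ : Real.Angle)) with hκ
  have hdec : deriv (curve Γ) t = κ • u' (θ : Real.Angle) := by
    refine eq_of_inner_eq θ ?_ ?_
    · rw [hperp]
      have := inner_smul_add_smul_u 0 κ θ
      rw [zero_smul, zero_add] at this
      exact this.symm
    · have := inner_smul_add_smul_u' 0 κ θ
      rw [zero_smul, zero_add] at this
      rw [this]
  have hκ0 : κ ≤ 0 := by
    rw [hdec, inner_smul_left] at hccw
    have e1 : inner ℝ (u' (θ : Real.Angle)) (u' (φ t : Real.Angle)) = Real.cos (θ - φ t) := by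
      rw [inner_u', Real.cos_sub]; simp [u']; ring
    rw [e1] at hccw
    simp only [conj_trivial] at hccw
    by_contra hcon
    nlinarith
  have hnorm : ‖deriv (curve Γ) t‖ = -κ := by
    have h1 := sq_inner_add_sq_inner (deriv (curve Γ) t) θ
    rw [hperp, ← hκ] at h1
    rw [← abs_of_nonpos hκ0, ← Real.sqrt_sq_eq_abs, ← Real.sqrt_sq (norm_nonneg _), ← h1]
    simp
  rw [hnorm, neg_smul, neg_neg]
  exact hdec

end IsBoundaryParam

/-! ### The area formula for the lower right part of the boundary -/

/-- The tangential component `-Γ'(t) · u'(θ)` of the velocity of the boundary curve. -/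
def tangSpeed (Γ : AddCircle L → Plane) (t θ : ℝ) : ℝ :=
  -inner ℝ (deriv (curve Γ) t) (u' (θ : Real.Angle))

/-- The largest offset of a point of `C` of height at most `lam`. -/
def reach (C : Set Plane) (θ lam : ℝ) : ℝ :=
  sSup ((fun a => offset C a θ) '' {a | a ∈ closure C ∧ height C a θ ≤ lam})

/-- The density `y dy` pulled back to the lower right part of the boundary below height `lam`. -/
def kernel (C : Set Plane) (Γ : AddCircle L → Plane) (lam t θ : ℝ) : ℝ :=
  if height C (curve Γ t) θ ≤ lam then max (offset C (curve Γ t) θ) 0 * max (tangSpeed Γ t θ) 0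
  else 0

theorem hasDerivAt_offset_curve {t : ℝ} (hd : DifferentiableAt ℝ (curve Γ) t) (θ : ℝ) :
    HasDerivAt (fun t => offset C (curve Γ t) θ) (tangSpeed Γ t θ) t := by
  have := (hd.hasDerivAt.inner ℝ (hasDerivAt_const t (u' (θ : Real.Angle)))).const_sub
    (deriv (fun t : ℝ => infHeight C t) θ)
  simpa [tangSpeed, offset] using this

theorem eq_of_height_eq_of_offset_eq {a b : Plane} {θ : ℝ} (h : height C a θ = height C b θ)
    (h' : offset C a θ = offset C b θ) : a = b := by
  unfold height at h
  unfold offset at h'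
  exact eq_of_inner_eq θ (by linarith) (by linarith)

theorem continuous_offset (C : Set Plane) (θ : ℝ) : Continuous fun a => offset C a θ :=
  continuous_const.sub (continuous_id.inner continuous_const)

theorem continuous_height_left (C : Set Plane) (θ : ℝ) :
    Continuous fun a => height C a θ :=
  (continuous_id.inner continuous_const).sub continuous_const

theorem lipschitzWith_offset (C : Set Plane) (θ : ℝ) :
    LipschitzWith 1 fun a => offset C a θ := by
  refine LipschitzWith.of_dist_le_mul fun a b => ?_
  rw [NNReal.coe_one, one_mul, Real.dist_eq, dist_comm, dist_eq_norm, offset, offset,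
    sub_sub_sub_cancel_left, ← inner_sub_left]
  exact abs_inner_u'_le _ _

theorem offset_combo (a b : Plane) (θ : ℝ) {s t : ℝ} (h : s + t = 1) :
    offset C (s • a + t • b) θ = s * offset C a θ + t * offset C b θ := by
  simp only [offset, inner_add_left, inner_smul_left, conj_trivial]
  linear_combination (-deriv (fun t : ℝ => infHeight C t) θ) * h

theorem height_combo (a b : Plane) (θ : ℝ) {s t : ℝ} (h : s + t = 1) :
    height C (s • a + t • b) θ = s * height C a θ + t * height C b θ := by
  simp only [height, inner_add_left, inner_smul_left, conj_trivial]
  linear_combination (infHeight C (θ : Real.Angle)) * h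

/-- With θ₀ a normal at Γ(t), the product equals ‖Γ'(t)‖ times the height of b in direction θ₀.
Consequently positive tangential speed forces Γ(t) to be the lowest point of the closure of C on its
line parallel to u(θ). -/
theorem IsBoundaryParam.height_sub_mul_tangSpeed_nonneg [hL : Fact (0 < L)]
    (hΓ : IsBoundaryParam C Γ) (hC : IsBody C) {t : ℝ} (θ : ℝ)
    (hd : DifferentiableAt ℝ (curve Γ) t) {b : Plane} (hb : b ∈ closure C)
    (h : offset C b θ = offset C (curve Γ t) θ) :
    0 ≤ (height C b θ - height C (curve Γ t) θ) * tangSpeed Γ t θ := by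
  obtain ⟨θ₀, h₀⟩ := hC.exists_normal (hΓ.mem_frontier (t : AddCircle L))
  have h1 := hΓ.deriv_curve_eq hC hd h₀
  have h2 := hC.height_nonneg hb θ₀
  have h3 : tangSpeed Γ t θ = ‖deriv (curve Γ) t‖ * Real.cos (θ - θ₀) := by
    rw [tangSpeed, h1, inner_neg_left, inner_smul_left, neg_neg]
    simp only [conj_trivial, norm_neg, norm_smul, norm_norm]
    have e1 : inner ℝ (u' (θ₀ : Real.Angle)) (u' (θ : Real.Angle)) = Real.cos (θ - θ₀) := by
      rw [inner_u', Real.cos_sub]; simp [u']; ring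
    have e2 : ‖u' (θ₀ : Real.Angle)‖ = 1 := by
      rw [EuclideanSpace.norm_eq]
      simp [u', Fin.sum_univ_two, add_comm]
    rw [e1, e2, mul_one]
  have h4 : height C b θ₀ = (height C b θ - height C (curve Γ t) θ) * Real.cos (θ - θ₀) := by
    have e1 := inner_u_sub (b - curve Γ t) θ (θ - θ₀)
    rw [sub_sub_cancel, inner_sub_left, inner_sub_left, inner_sub_left] at e1
    change height C (curve Γ t) θ₀ = 0 at h₀
    unfold height offset at *
    have h5 : inner ℝ b (u' (θ : Real.Angle)) - inner ℝ (curve Γ t) (u' (θ : Real.Angle)) = 0 := by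
      linarith
    rw [h5, zero_mul, sub_zero] at e1
    linarith
  rw [h3, mul_left_comm, ← h4]
  exact mul_nonneg (norm_nonneg _) h2

namespace IsBody

theorem bddAbove_offset (hC : IsBody C) (θ : ℝ) (lam : ℝ) :
    BddAbove ((fun a => offset C a θ) '' {a | a ∈ closure C ∧ height C a θ ≤ lam}) := by
  obtain ⟨D, -, hD⟩ := hC.exists_offset_bound
  exact ⟨D, by rintro _ ⟨a, ha, rfl⟩; exact (abs_le.1 (hD a ha.1 θ)).2⟩

theorem offset_le_reach (hC : IsBody C) {θ : ℝ} {a : Plane} {lam : ℝ}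
    (ha : a ∈ closure C) (h : height C a θ ≤ lam) :
    offset C a θ ≤ reach C θ lam :=
  le_csSup (hC.bddAbove_offset θ lam) ⟨a, ⟨ha, h⟩, rfl⟩

theorem reach_nonneg (hC : IsBody C) {θ : ℝ}
    (hθ : DifferentiableAt ℝ (fun t : ℝ => infHeight C t) θ) {lam : ℝ} (hlam : 0 ≤ lam) :
    0 ≤ reach C θ lam := by
  obtain ⟨a, ha, h0⟩ := hC.exists_height_eq_zero θ
  rw [← hC.offset_eq_zero hθ ha h0]
  exact hC.offset_le_reach ha (h0.trans_le hlam)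

theorem exists_lt_offset (hC : IsBody C) {θ lam y : ℝ} (hlam : 0 ≤ lam)
    (hy : y < reach C θ lam) :
    ∃ a ∈ closure C, height C a θ ≤ lam ∧ y < offset C a θ := by
  obtain ⟨b, hb, h0⟩ := hC.exists_height_eq_zero θ
  have hne : ((fun a => offset C a θ) '' {a | a ∈ closure C ∧ height C a θ ≤ lam}).Nonempty :=
    ⟨_, b, ⟨hb, h0.trans_le hlam⟩, rfl⟩
  obtain ⟨_, ⟨a, ha, rfl⟩, h⟩ := exists_lt_of_lt_csSup hne hy
  exact ⟨a, ha.1, ha.2, h⟩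

theorem exists_interior_offset_eq (hC : IsBody C) {θ y : ℝ} {p b : Plane} (hp : p ∈ closure C)
    (hb : b ∈ closure C) (h1 : offset C p θ < y) (h2 : y < offset C b θ) :
    ∃ w ∈ interior C, offset C w θ = y := by
  obtain ⟨c, hc⟩ := hC.interior_nonempty
  have key : ∀ q ∈ closure C, ∀ s : ℝ, 0 < s → s ≤ 1 →
      y = s * offset C c θ + (1 - s) * offset C q θ → ∃ w ∈ interior C, offset C w θ = y := by
    intro q hq s hs hs1 hy
    refine ⟨s • c + (1 - s) • q, hC.convex.combo_interior_closure_mem_interior hc hq hs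
      (by linarith) (by ring), ?_⟩
    rw [offset_combo _ _ _ (by ring), ← hy]
  rcases le_total (offset C c θ) y with h | h
  · have hpos : 0 < offset C b θ - offset C c θ := by linarith
    refine key b hb ((offset C b θ - y) / (offset C b θ - offset C c θ))
      (div_pos (by linarith) hpos) ((div_le_one hpos).2 (by linarith)) ?_
    field_simp
    ring
  · have hpos : 0 < offset C c θ - offset C p θ := by linarith
    refine key p hp ((y - offset C p θ) / (offset C c θ - offset C p θ))
      (div_pos (by linarith) hpos) ((div_le_one hpos).2 (by linarith)) ?_
    field_simp
    ring

/-- The point is the lowest one of the closure with offset y. It is on the frontier since it cannot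
be moved down. -/
theorem exists_lower_boundary_point (hC : IsBody C) {θ : ℝ}
    (hθ : DifferentiableAt ℝ (fun t : ℝ => infHeight C t) θ) [hL : Fact (0 < L)]
    (hΓ : IsBoundaryParam C Γ)
    {lam y : ℝ} (hlam : 0 ≤ lam) (hy0 : 0 < y) (hy : y < reach C θ lam) :
    ∃ t ∈ Ioc 0 L, offset C (curve Γ t) θ = y ∧ height C (curve Γ t) θ ≤ lam ∧
      (DifferentiableAt ℝ (curve Γ) t → 0 ≤ tangSpeed Γ t θ) := by
  obtain ⟨p, hp, hp0⟩ := hC.exists_height_eq_zero θ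
  have hpo := hC.offset_eq_zero hθ hp hp0
  obtain ⟨b, hb, hbl, hyb⟩ := hC.exists_lt_offset hlam hy
  obtain ⟨w, hw, hwy⟩ := hC.exists_interior_offset_eq hp hb (hpo.trans_lt hy0) hyb
  have hcomp : IsCompact {a | a ∈ closure C ∧ offset C a θ = y} :=
    hC.isCompact_closure.inter_right (isClosed_eq (continuous_offset C θ) continuous_const)
  obtain ⟨a, ⟨ha, hay⟩, hmin⟩ := hcomp.exists_isMinOn
    ⟨w, subset_closure (interior_subset hw), hwy⟩ (continuous_height_left C θ).continuousOn
  have hfr : a ∈ frontier C := by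
    refine mem_frontier_of_forall_not_mem (v := -u (θ : Real.Angle)) ha fun t ht hmem => ?_
    have e1 : inner ℝ (u (θ : Real.Angle)) (u' (θ : Real.Angle)) = (0 : ℝ) := by
      have := inner_smul_add_smul_u' 1 0 θ; simpa using this
    have e2 : inner ℝ (u (θ : Real.Angle)) (u (θ : Real.Angle)) = (1 : ℝ) := by
      have := inner_smul_add_smul_u 1 0 θ; simpa using this
    have h1 : offset C (a + t • -u (θ : Real.Angle)) θ = y := by
      rw [← hay]; simp [offset, inner_add_left, inner_smul_left, inner_neg_left, e1]
    have h2 : height C (a + t • -u (θ : Real.Angle)) θ = height C a θ - t := by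
      simp only [height, inner_add_left, inner_smul_left, inner_neg_left, e2, conj_trivial]
      ring
    have h3 : height C a θ ≤ height C (a + t • -u (θ : Real.Angle)) θ := hmin ⟨hmem, h1⟩
    linarith
  have hal : height C a θ ≤ lam := by
    -- The segment from the contact point p to b crosses offset y at this ratio, at height no larger
    -- than that of b.
    set s := y / offset C b θ with hs
    have hb0 : 0 < offset C b θ := hy0.trans hyb
    have hs0 : 0 ≤ s := by positivity
    have hs1 : s ≤ 1 := (div_le_one hb0).2 hyb.le
    have hmem : (1 - s) • p + s • b ∈ closure C :=
      hC.convex.closure hp hb (by linarith) hs0 (by ring)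
    have h1 : offset C ((1 - s) • p + s • b) θ = y := by
      rw [offset_combo _ _ _ (by ring), hpo, hs]; field_simp; ring
    have h2 := hmin ⟨hmem, h1⟩
    have h3 : height C ((1 - s) • p + s • b) θ = s * height C b θ := by
      rw [height_combo _ _ _ (by ring), hp0]; ring
    have h4 := hC.height_nonneg hb θ
    have h5 : s * height C b θ ≤ 1 * height C b θ := mul_le_mul_of_nonneg_right hs1 h4
    change height C a θ ≤ height C ((1 - s) • p + s • b) θ at h2
    linarith
  obtain ⟨t, ht, rfl⟩ := hΓ.exists_mem_Ioc hfr
  refine ⟨t, ht, hay, hal, fun hd => ?_⟩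
  have h1 := hΓ.height_sub_mul_tangSpeed_nonneg hC θ hd (subset_closure (interior_subset hw))
    (hwy.trans hay.symm)
  have h2 : height C (curve Γ t) θ < height C w θ := by
    refine lt_of_le_of_ne (hmin ⟨subset_closure (interior_subset hw), hwy⟩) fun h => ?_
    exact hfr.2 (eq_of_height_eq_of_offset_eq h (hay.trans hwy.symm) ▸ hw)
  exact nonneg_of_mul_nonneg_right h1 (by linarith)

end IsBody

theorem measurable_tangSpeed (Γ : AddCircle L → Plane) :
    Measurable fun p : ℝ × ℝ => tangSpeed Γ p.1 p.2 :=
  (((measurable_deriv (curve Γ)).comp measurable_fst).inner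
    (continuous_u'.measurable.comp measurable_snd)).neg

theorem IsBoundaryParam.measurable_offset_curve (hΓ : IsBoundaryParam C Γ) :
    Measurable fun p : ℝ × ℝ => offset C (curve Γ p.1) p.2 :=
  ((measurable_deriv _).comp measurable_snd).sub
    ((hΓ.lipschitzWith.continuous.measurable.comp measurable_fst).inner
      (continuous_u'.measurable.comp measurable_snd))

theorem IsBoundaryParam.measurable_height_curve (hΓ : IsBoundaryParam C Γ) (hC : IsBody C) :
    Measurable fun p : ℝ × ℝ => height C (curve Γ p.1) p.2 :=
  ((hΓ.lipschitzWith.continuous.measurable.comp measurable_fst).inner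
    (continuous_u.measurable.comp measurable_snd)).sub
      (hC.continuous_infHeight.measurable.comp measurable_snd)

theorem IsBoundaryParam.measurable_kernel (hΓ : IsBoundaryParam C Γ) (hC : IsBody C) (lam : ℝ) :
    Measurable fun p : ℝ × ℝ => kernel C Γ lam p.1 p.2 :=
  Measurable.ite (measurableSet_le (hΓ.measurable_height_curve hC) measurable_const)
    ((hΓ.measurable_offset_curve.max measurable_const).mul
      ((measurable_tangSpeed Γ).max measurable_const)) measurable_const

theorem kernel_nonneg (C : Set Plane) (Γ : AddCircle L → Plane) (lam t θ : ℝ) :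
    0 ≤ kernel C Γ lam t θ := by
  unfold kernel
  split_ifs
  · exact mul_nonneg (le_max_right _ _) (le_max_right _ _)
  · exact le_rfl

theorem volume_image_eq_zero_of_lipschitzWith {f : ℝ → ℝ} {K : NNReal} (hf : LipschitzWith K f)
    {s : Set ℝ} (hs : volume s = 0) : volume (f '' s) = 0 := by
  have := hf.hausdorffMeasure_image_le (d := 1) zero_le_one s
  rw [hausdorffMeasure_real, hs, mul_zero] at this
  exact le_antisymm this zero_le

/-- The parameters of the lower right part of the boundary below height `lam`. -/
def lowerRight (C : Set Plane) (Γ : AddCircle L → Plane) (lam θ : ℝ) : Set ℝ :=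
  {t | DifferentiableAt ℝ (curve Γ) t ∧ height C (curve Γ t) θ ≤ lam ∧
    0 < offset C (curve Γ t) θ ∧ 0 < tangSpeed Γ t θ ∧ t ∈ Ioc 0 L}

namespace IsBoundaryParam

theorem measurableSet_lowerRight (hΓ : IsBoundaryParam C Γ) (lam θ : ℝ) :
    MeasurableSet (lowerRight C Γ lam θ) := by
  have hmh : Measurable fun t => height C (curve Γ t) θ :=
    ((continuous_height_left C θ).comp hΓ.lipschitzWith.continuous).measurable
  have hmx : Measurable fun t => offset C (curve Γ t) θ :=
    ((continuous_offset C θ).comp hΓ.lipschitzWith.continuous).measurable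
  have hmt : Measurable fun t => tangSpeed Γ t θ :=
    ((measurable_deriv (curve Γ)).inner measurable_const).neg
  simp only [lowerRight, ofPred_and]
  exact (measurableSet_of_differentiableAt ℝ (curve Γ)).inter
      ((measurableSet_le hmh measurable_const).inter ((measurableSet_lt measurable_const hmx).inter
        ((measurableSet_lt measurable_const hmt).inter measurableSet_Ioc)))

theorem lipschitzWith_offset_curve (hΓ : IsBoundaryParam C Γ) (θ : ℝ) :
    LipschitzWith (1 * 1) fun t => offset C (curve Γ t) θ :=
  (lipschitzWith_offset C θ).comp hΓ.lipschitzWith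

theorem injOn_lowerRight [hL : Fact (0 < L)] (hΓ : IsBoundaryParam C Γ)
    (hC : IsBody C) (lam θ : ℝ) :
    InjOn (fun t => offset C (curve Γ t) θ) (lowerRight C Γ lam θ) := by
  rintro s ⟨hsd, -, -, hst, hs⟩ t ⟨htd, -, -, htt, ht⟩ hst'
  have hxx : offset C (curve Γ s) θ = offset C (curve Γ t) θ := hst'
  have h1 := hΓ.height_sub_mul_tangSpeed_nonneg hC θ hsd (hΓ.mem_closure t) hxx.symm
  have h2 := hΓ.height_sub_mul_tangSpeed_nonneg hC θ htd (hΓ.mem_closure s) hxx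
  have h3 := nonneg_of_mul_nonneg_left h1 hst
  have h4 := nonneg_of_mul_nonneg_left h2 htt
  have h5 : curve Γ s = curve Γ t := by
    refine eq_of_height_eq_of_offset_eq (C := C) (θ := θ) ?_ hxx
    change 0 ≤ height C (curve Γ t) θ - _ at h3
    change 0 ≤ height C (curve Γ s) θ - _ at h4
    linarith
  rw [← zero_add L] at hs ht
  exact hΓ.injOn_curve 0 hs ht h5

/-- Every y strictly between 0 and the reach is the offset of a lower boundary point. Those missed
come from parameters without derivative, a null set with null Lipschitz image, or with zero
tangential speed, whose image is null by the one-dimensional Sard argument. -/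
theorem image_lowerRight [hL : Fact (0 < L)] (hΓ : IsBoundaryParam C Γ)
    (hC : IsBody C) {θ lam : ℝ} (hθ : DifferentiableAt ℝ (fun t : ℝ => infHeight C t) θ)
    (hlam : 0 ≤ lam) :
    (fun t => offset C (curve Γ t) θ) '' lowerRight C Γ lam θ =ᵐ[volume]
      Ioc 0 (reach C θ lam) := by
  set x : ℝ → ℝ := fun t => offset C (curve Γ t) θ with hx
  have hxlip : LipschitzWith (1 * 1) x := hΓ.lipschitzWith_offset_curve θ
  refine ae_eq_set.2 ⟨?_, ?_⟩
  · rw [sdiff_eq_empty.2, measure_empty]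
    rintro _ ⟨t, ⟨-, ht1, ht2, -⟩, rfl⟩
    exact ⟨ht2, hC.offset_le_reach (hΓ.mem_closure t) ht1⟩
  · set N : Set ℝ := {t | ¬ DifferentiableAt ℝ (curve Γ) t} with hN
    set Z : Set ℝ := {t | DifferentiableAt ℝ (curve Γ) t ∧ tangSpeed Γ t θ = 0} with hZ
    have hN0 : volume (x '' N) = 0 :=
      volume_image_eq_zero_of_lipschitzWith hxlip hΓ.lipschitzWith.ae_differentiableAt
    have hZ0 : volume (x '' Z) = 0 := by
      refine addHaar_image_eq_zero_of_det_fderivWithin_eq_zero volume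
        (f' := fun _ => (0 : ℝ →L[ℝ] ℝ)) (fun t ht => ?_) (fun t ht => ?_)
      · have h1 := (hasDerivAt_offset_curve (C := C) ht.1 θ).hasDerivWithinAt (s := Z)
        rw [ht.2] at h1
        simpa using h1.hasFDerivWithinAt
      · simp [ContinuousLinearMap.det]
    refine measure_mono_null (t := {reach C θ lam} ∪ (x '' N ∪ x '' Z)) ?_
      (measure_union_null (measure_singleton _) (measure_union_null hN0 hZ0))
    rintro y ⟨⟨hy0, hyM⟩, hyS⟩
    rcases hyM.eq_or_lt with h | h
    · exact Or.inl h
    · right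
      obtain ⟨t, ht, hty, htl, htd⟩ := hC.exists_lower_boundary_point hθ hΓ hlam hy0 h
      by_cases hd : DifferentiableAt ℝ (curve Γ) t
      · right
        refine ⟨t, ⟨hd, ?_⟩, hty⟩
        by_contra hne
        exact hyS ⟨t, ⟨hd, htl, hty.symm ▸ hy0, lt_of_le_of_ne (htd hd) (Ne.symm hne), ht⟩, hty⟩
      · exact Or.inl ⟨t, hd, hty⟩

theorem kernel_eq_indicator {θ lam t : ℝ} (hd : DifferentiableAt ℝ (curve Γ) t)
    (ht : t ∈ Ioc 0 L) :
    kernel C Γ lam t θ = (lowerRight C Γ lam θ).indicator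
      (fun t => |tangSpeed Γ t θ| • offset C (curve Γ t) θ) t := by
  by_cases h : t ∈ lowerRight C Γ lam θ
  · rw [indicator_of_mem h]
    obtain ⟨-, hl, hx, ht, -⟩ := h
    rw [kernel, if_pos hl, max_eq_left hx.le, max_eq_left ht.le, abs_of_pos ht, smul_eq_mul,
      mul_comm]
  · rw [indicator_of_notMem h, kernel]
    split_ifs with hl
    · by_cases h3 : 0 < offset C (curve Γ t) θ
      · have h4 : ¬ 0 < tangSpeed Γ t θ := fun h4 => h ⟨hd, hl, h3, h4, ht⟩
        rw [max_eq_right (not_lt.1 h4), mul_zero]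
      · rw [max_eq_right (not_lt.1 h3), zero_mul]
    · rfl

/-- The change of variables y = offset, injective on `lowerRight`, turns the left side into the
integral of y over (0, reach]. -/
theorem integral_kernel [hL : Fact (0 < L)] (hΓ : IsBoundaryParam C Γ)
    (hC : IsBody C) {θ lam : ℝ} (hθ : DifferentiableAt ℝ (fun t : ℝ => infHeight C t) θ)
    (hlam : 0 ≤ lam) :
    ∫ t in Ioc 0 L, kernel C Γ lam t θ = reach C θ lam ^ 2 / 2 := by
  have hSm := hΓ.measurableSet_lowerRight lam θ
  have h1 := integral_image_eq_integral_abs_deriv_smul (f' := fun t => tangSpeed Γ t θ) hSm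
    (fun t ht => (hasDerivAt_offset_curve (C := C) ht.1 θ).hasDerivWithinAt)
    (hΓ.injOn_lowerRight hC lam θ) (fun y => y)
  rw [setIntegral_congr_set (hΓ.image_lowerRight hC hθ hlam),
    ← intervalIntegral.integral_of_le (hC.reach_nonneg hθ hlam), integral_id] at h1
  have h2 : ∫ t in Ioc 0 L, kernel C Γ lam t θ = ∫ t in Ioc 0 L, (lowerRight C Γ lam θ).indicator
      (fun t => |tangSpeed Γ t θ| • offset C (curve Γ t) θ) t := by
    refine setIntegral_congr_ae measurableSet_Ioc ?_
    filter_upwards [hΓ.lipschitzWith.ae_differentiableAt] with t hd ht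
    exact kernel_eq_indicator hd ht
  have h3 : Ioc 0 L ∩ lowerRight C Γ lam θ = lowerRight C Γ lam θ :=
    inter_eq_right.2 fun t ht => ht.2.2.2.2
  rw [h2, setIntegral_indicator hSm, h3, ← h1]
  ring

end IsBoundaryParam

/-! ### The integral of the squared reach -/

theorem isClosed_setOf_exists_mem {X Y : Type*} [TopologicalSpace X] [TopologicalSpace Y]
    {K : Set X} (hK : IsCompact K) {Z : Set (X × Y)} (hZ : IsClosed Z) :
    IsClosed {y | ∃ x ∈ K, (x, y) ∈ Z} := by
  have : CompactSpace K := isCompact_iff_compactSpace.1 hK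
  have h1 : IsClosed ((fun p : K × Y => ((p.1 : X), p.2)) ⁻¹' Z) := hZ.preimage (by fun_prop)
  convert isClosedMap_snd_of_compactSpace _ h1 using 1
  ext y
  constructor
  · rintro ⟨x, hx, h⟩
    exact ⟨(⟨x, hx⟩, y), h, rfl⟩
  · rintro ⟨⟨x, y⟩, h, rfl⟩
    exact ⟨x, x.2, h⟩

theorem exists_lipschitzWith_height (hC : IsBody C) (a : Plane) :
    ∃ K, LipschitzWith K (height C a) := by
  obtain ⟨K, hK⟩ := hC.exists_lipschitz
  have h1 : LipschitzWith (‖innerSL ℝ a‖₊ * 2) (fun θ : ℝ => innerSL ℝ a (u (θ : Real.Angle))) :=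
    (innerSL ℝ a).lipschitz.comp lipschitz_u
  exact ⟨_, h1.sub hK⟩

/-- The positive part of the offset at heights at most `lam`. -/
def cutOffset (C : Set Plane) (a : Plane) (lam θ : ℝ) : ℝ :=
  if height C a θ ≤ lam then max (offset C a θ) 0 else 0

theorem cutOffset_nonneg (C : Set Plane) (a : Plane) (lam θ : ℝ) : 0 ≤ cutOffset C a lam θ := by
  unfold cutOffset
  split_ifs
  · exact le_max_right _ _
  · exact le_rfl

theorem measurable_offset_right (C : Set Plane) (a : Plane) : Measurable (offset C a) :=
  (measurable_deriv _).sub (measurable_const.inner continuous_u'.measurable)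

namespace IsBody

theorem measurable_height_right (hC : IsBody C) (a : Plane) : Measurable (height C a) :=
  (exists_lipschitzWith_height hC a).choose_spec.continuous.measurable

theorem measurable_cutOffset (hC : IsBody C) (a : Plane) (lam : ℝ) :
    Measurable (cutOffset C a lam) :=
  Measurable.ite (measurableSet_le (hC.measurable_height_right a) measurable_const)
    ((measurable_offset_right C a).max measurable_const) measurable_const

theorem integrableOn_cutOffset (hC : IsBody C) {a : Plane} (ha : a ∈ closure C) (lam x y : ℝ) :
    IntegrableOn (cutOffset C a lam) (Ioc x y) := by
  obtain ⟨D, hD, h⟩ := hC.exists_offset_bound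
  refine Integrable.of_bound (hC.measurable_cutOffset a lam).aestronglyMeasurable D
    (Eventually.of_forall fun θ => ?_)
  rw [Real.norm_eq_abs, abs_of_nonneg (cutOffset_nonneg _ _ _ _), cutOffset]
  split_ifs
  · exact max_le (abs_le.1 (h a ha θ)).2 hD.le
  · exact hD.le

/-- To the left of the normal ϑ the height decreases to 0, so the angles with height at most `lam`
form an interval from m to ϑ. There the cut offset is minus the derivative of the height, and the
integral telescopes. -/
theorem exists_integral_cutOffset_eq (hC : IsBody C) {a : Plane} (ha : a ∈ closure C)
    {ϑ lam δ : ℝ} (h0 : height C a ϑ = 0) (hlam : 0 ≤ lam) (hδ : 0 ≤ δ) (hδ' : δ ≤ Real.pi / 2) :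
    ∃ m ∈ Icc (ϑ - δ) ϑ, height C a m ≤ lam ∧ (lam ≤ height C a (ϑ - δ) → height C a m = lam) ∧
      ∫ θ in Ioc (ϑ - δ) ϑ, cutOffset C a lam θ = height C a m := by
  obtain ⟨K, hK⟩ := exists_lipschitzWith_height hC a
  have hanti : AntitoneOn (height C a) (Icc (ϑ - δ) ϑ) :=
    (hC.antitoneOn_height ha h0).mono (Icc_subset_Icc_left (by linarith))
  have hcomp : IsCompact {θ | θ ∈ Icc (ϑ - δ) ϑ ∧ height C a θ ≤ lam} :=
    isCompact_Icc.inter_right (isClosed_le hK.continuous continuous_const)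
  obtain ⟨m, ⟨hm, hml⟩, hmin⟩ := hcomp.exists_isLeast
    ⟨ϑ, ⟨by linarith, le_rfl⟩, h0.trans_le hlam⟩
  refine ⟨m, hm, hml, fun hle => ?_, ?_⟩
  · obtain ⟨z, hz, hzl⟩ := intermediate_value_Icc' hm.1 hK.continuous.continuousOn ⟨hml, hle⟩
    have h1 := hmin ⟨⟨hz.1, hz.2.trans hm.2⟩, hzl.le⟩
    rw [le_antisymm h1 hz.2, hzl]
  · have h1 : ∫ θ in Ioc (ϑ - δ) ϑ, cutOffset C a lam θ =
        ∫ θ in Ioc (ϑ - δ) ϑ, (Ioc m ϑ).indicator (fun θ => -deriv (height C a) θ) θ := by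
      refine setIntegral_congr_ae measurableSet_Ioc ?_
      filter_upwards [hC.ae_differentiableAt, compl_mem_ae_iff.2 (measure_singleton m),
        compl_mem_ae_iff.2 (measure_singleton ϑ)] with θ hθ hθm hθϑ hθI
      have hθlt : θ < ϑ := lt_of_le_of_ne hθI.2 hθϑ
      have hoff : 0 ≤ offset C a θ :=
        hC.offset_nonneg ha h0 hθ ⟨by linarith [hθI.1], hθlt⟩
      by_cases h : m < θ
      · rw [indicator_of_mem (show θ ∈ Ioc m ϑ from ⟨h, hθI.2⟩), (hasDerivAt_height hθ).deriv,
          cutOffset, if_pos ((hanti hm ⟨hθI.1.le, hθI.2⟩ h.le).trans hml), max_eq_left hoff,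
          neg_neg]
      · rw [indicator_of_notMem fun h' => h h'.1, cutOffset, if_neg]
        intro hle
        exact h (lt_of_le_of_ne (hmin ⟨⟨hθI.1.le, hθI.2⟩, hle⟩) (Ne.symm hθm))
    rw [h1, setIntegral_indicator measurableSet_Ioc,
      inter_eq_right.2 (Ioc_subset_Ioc_left hm.1), integral_neg,
      ← intervalIntegral.integral_of_le hm.2,
      (hK.lipschitzOnWith (s := uIcc m ϑ)).absolutelyContinuousOnInterval.integral_deriv_eq_sub, h0]
    ring

end IsBody

/-! ### The kernel at a fixed boundary point as a function of the angle -/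

theorem kernel_eq_cutOffset_mul (C : Set Plane) (Γ : AddCircle L → Plane) (lam t θ : ℝ) :
    kernel C Γ lam t θ = cutOffset C (curve Γ t) lam θ * max (tangSpeed Γ t θ) 0 := by
  unfold kernel cutOffset
  split_ifs <;> simp

namespace IsBoundaryParam

theorem abs_tangSpeed_le (hΓ : IsBoundaryParam C Γ) (t θ : ℝ) : |tangSpeed Γ t θ| ≤ 1 := by
  rw [tangSpeed, abs_neg]
  exact (abs_inner_u'_le _ _).trans (norm_deriv_le_of_lipschitzWith hΓ.lipschitzWith t)

theorem kernel_le_cutOffset (hΓ : IsBoundaryParam C Γ) (lam t θ : ℝ) :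
    kernel C Γ lam t θ ≤ cutOffset C (curve Γ t) lam θ := by
  rw [kernel_eq_cutOffset_mul]
  exact mul_le_of_le_one_right (cutOffset_nonneg _ _ _ _)
    (max_le ((le_abs_self _).trans (hΓ.abs_tangSpeed_le t θ)) zero_le_one)

theorem exists_kernel_bound (hΓ : IsBoundaryParam C Γ) (hC : IsBody C) :
    ∃ D : ℝ, ∀ lam t θ, ‖kernel C Γ lam t θ‖ ≤ D := by
  obtain ⟨D, hD, h⟩ := hC.exists_offset_bound
  refine ⟨D, fun lam t θ => ?_⟩
  rw [Real.norm_eq_abs, abs_of_nonneg (kernel_nonneg _ _ _ _ _)]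
  refine (hΓ.kernel_le_cutOffset lam t θ).trans ?_
  rw [cutOffset]
  split_ifs
  · exact max_le (abs_le.1 (h _ (hΓ.mem_closure t) θ)).2 hD.le
  · exact hD.le

theorem tangSpeed_eq_cos [hL : Fact (0 < L)] (hΓ : IsBoundaryParam C Γ) (hC : IsBody C)
    {t ϑ : ℝ} (hd : DifferentiableAt ℝ (curve Γ) t) (h1 : ‖deriv (curve Γ) t‖ = 1)
    (h0 : height C (curve Γ t) ϑ = 0) (θ : ℝ) : tangSpeed Γ t θ = Real.cos (θ - ϑ) := by
  rw [tangSpeed, hΓ.deriv_curve_eq hC hd h0, h1, one_smul, inner_neg_left, neg_neg, inner_u',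
    Real.cos_sub]
  simp [u']
  ring

/-- A unit tangent determines the normal: a second normal θ would give tangential speed cos 0 = 1
instead of cos(θ - ϑ). -/
theorem height_pos_of_cos_lt_one [hL : Fact (0 < L)] (hΓ : IsBoundaryParam C Γ) (hC : IsBody C)
    {t ϑ : ℝ} (hd : DifferentiableAt ℝ (curve Γ) t) (h1 : ‖deriv (curve Γ) t‖ = 1)
    (h0 : height C (curve Γ t) ϑ = 0) {θ : ℝ} (hθ : Real.cos (θ - ϑ) < 1) :
    0 < height C (curve Γ t) θ := by
  refine lt_of_le_of_ne (hC.height_nonneg (hΓ.mem_closure t) θ) fun h => ?_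
  have h2 := hΓ.tangSpeed_eq_cos hC hd h1 h0 θ
  rw [hΓ.tangSpeed_eq_cos hC hd h1 h.symm θ, sub_self, Real.cos_zero] at h2
  linarith

/-- A nonzero kernel needs cos(θ - ϑ) > 0 and a positive offset. The first confines θ to the
quarter-turns on either side of a copy of ϑ modulo 2π, and the second excludes those after it. Two
copies remain because θ and ϑ may be placed anywhere in one window of length 2π. -/
theorem mem_of_kernel_ne_zero [hL : Fact (0 < L)] (hΓ : IsBoundaryParam C Γ) (hC : IsBody C)
    {t ϑ : ℝ} (hd : DifferentiableAt ℝ (curve Γ) t) (h1 : ‖deriv (curve Γ) t‖ = 1)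
    (h0 : height C (curve Γ t) ϑ = 0) {lam θ : ℝ}
    (hθ : DifferentiableAt ℝ (fun t : ℝ => infHeight C t) θ)
    (hlt : ϑ - 2 * Real.pi < θ) (hgt : θ < ϑ + 2 * Real.pi) (hk : kernel C Γ lam t θ ≠ 0) :
    θ ∈ Ioc (ϑ - Real.pi / 2) ϑ ∨
      θ ∈ Ioc (ϑ + 2 * Real.pi - Real.pi / 2) (ϑ + 2 * Real.pi) := by
  have hpi := Real.pi_pos
  have hmem := hΓ.mem_closure (t : AddCircle L)
  have h0' : height C (curve Γ t) (ϑ - 2 * Real.pi) = 0 := by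
    rw [← height_add_two_pi, sub_add_cancel, h0]
  have hcos : 0 < Real.cos (θ - ϑ) := by
    rw [← hΓ.tangSpeed_eq_cos hC hd h1 h0 θ]
    by_contra h
    rw [kernel_eq_cutOffset_mul, max_eq_right (not_lt.1 h), mul_zero] at hk
    exact hk rfl
  have hoff : 0 < offset C (curve Γ t) θ := by
    by_contra h
    rw [kernel, max_eq_right (not_lt.1 h), zero_mul, ite_self] at hk
    exact hk rfl
  by_contra! hcon
  obtain ⟨hc1, hc2⟩ := hcon
  simp only [mem_Ioc, not_and_or, not_lt, not_le] at hc1 hc2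
  rcases hc1 with hc1 | hc1
  · rcases lt_or_ge (θ - ϑ) (-(3 * Real.pi / 2)) with h | h
    · exact hoff.not_ge (hC.offset_nonpos hmem h0' hθ ⟨hlt, by linarith⟩)
    · have := Real.cos_nonpos_of_pi_div_two_le_of_le (x := -(θ - ϑ)) (by linarith) (by linarith)
      rw [Real.cos_neg] at this
      linarith
  · rcases lt_or_ge (θ - ϑ) (Real.pi / 2) with h | h
    · exact hoff.not_ge (hC.offset_nonpos hmem h0 hθ ⟨hc1, by linarith⟩)
    · have h3 : θ ≤ ϑ + 2 * Real.pi - Real.pi / 2 := by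
        rcases hc2 with hc2 | hc2 <;> linarith
      have := Real.cos_nonpos_of_pi_div_two_le_of_le (x := θ - ϑ) h (by linarith)
      linarith

theorem exists_normal_mem_Ioc (hΓ : IsBoundaryParam C Γ) (hC : IsBody C) (t α : ℝ) :
    ∃ ϑ ∈ Ioc α (α + 2 * Real.pi), height C (curve Γ t) ϑ = 0 := by
  obtain ⟨θ, hθ⟩ := hC.exists_normal (hΓ.mem_frontier (t : AddCircle L))
  refine ⟨toIocMod Real.two_pi_pos α θ, toIocMod_mem_Ioc _ _ _, ?_⟩
  have hp : Function.Periodic (height C (curve Γ t)) (2 * Real.pi) := height_add_two_pi _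
  have := hp.sub_zsmul_eq (x := θ) (toIocDiv Real.two_pi_pos α θ)
  rw [self_sub_toIocDiv_zsmul] at this
  exact this.trans hθ

theorem integrableOn_kernel (hΓ : IsBoundaryParam C Γ) (hC : IsBody C) (lam t x y : ℝ) :
    IntegrableOn (kernel C Γ lam t) (Ioc x y) := by
  obtain ⟨D, hD⟩ := hΓ.exists_kernel_bound hC
  exact Integrable.of_bound ((hΓ.measurable_kernel hC lam).comp
    (measurable_const.prodMk measurable_id)).aestronglyMeasurable D
    (Eventually.of_forall fun θ => hD _ _ _)

/-- Each of the two quarter-turns, before ϑ and before ϑ + 2π, contributes at most `lam`. The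
resulting uniform bound serves for dominated convergence. -/
theorem integral_kernel_le [hL : Fact (0 < L)] (hΓ : IsBoundaryParam C Γ) (hC : IsBody C)
    {t : ℝ} (hd : DifferentiableAt ℝ (curve Γ) t) (h1 : ‖deriv (curve Γ) t‖ = 1)
    {α β lam : ℝ} (hβ : β ≤ α + 2 * Real.pi) (hlam : 0 ≤ lam) :
    ∫ θ in Ioc α β, kernel C Γ lam t θ ≤ 2 * lam := by
  obtain ⟨ϑ, hϑ, h0⟩ := hΓ.exists_normal_mem_Ioc hC t α
  have hpi := Real.pi_pos
  have hmem := hΓ.mem_closure (t : AddCircle L)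
  have h0' : height C (curve Γ t) (ϑ + 2 * Real.pi) = 0 := by rw [height_add_two_pi, h0]
  set g := cutOffset C (curve Γ t) lam with hg
  have key : ∀ ψ, height C (curve Γ t) ψ = 0 →
      IntegrableOn ((Ioc (ψ - Real.pi / 2) ψ).indicator g) (Ioc α β) ∧
      ∫ θ in Ioc α β, (Ioc (ψ - Real.pi / 2) ψ).indicator g θ ≤ lam := by
    intro ψ hψ
    refine ⟨(hC.integrableOn_cutOffset hmem lam α β).indicator measurableSet_Ioc, ?_⟩
    obtain ⟨m, -, hm, -, he⟩ := hC.exists_integral_cutOffset_eq hmem hψ hlam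
      (by positivity : 0 ≤ Real.pi / 2) le_rfl
    rw [setIntegral_indicator measurableSet_Ioc]
    refine (setIntegral_mono_set (hC.integrableOn_cutOffset hmem lam _ _)
      (Eventually.of_forall fun θ => cutOffset_nonneg _ _ _ _)
      (Eventually.of_forall inter_subset_right)).trans (he.trans_le hm)
  have h2 := key ϑ h0
  have h3 := key (ϑ + 2 * Real.pi) h0'
  have h4 : ∫ θ in Ioc α β, kernel C Γ lam t θ ≤ ∫ θ in Ioc α β,
      ((Ioc (ϑ - Real.pi / 2) ϑ).indicator g θ +
        (Ioc (ϑ + 2 * Real.pi - Real.pi / 2) (ϑ + 2 * Real.pi)).indicator g θ) := by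
    refine setIntegral_mono_on_ae (hΓ.integrableOn_kernel hC lam t α β) (h2.1.add h3.1)
      measurableSet_Ioc ?_
    filter_upwards [hC.ae_differentiableAt] with θ hθ hθI
    have hnn : ∀ s : Set ℝ, 0 ≤ s.indicator g θ := fun s =>
      indicator_nonneg (fun θ _ => cutOffset_nonneg _ _ _ _) θ
    by_cases hk : kernel C Γ lam t θ = 0
    · rw [hk]; exact add_nonneg (hnn _) (hnn _)
    · have hle := hΓ.kernel_le_cutOffset lam t θ
      rcases hΓ.mem_of_kernel_ne_zero hC hd h1 h0 hθ (by linarith [hϑ.2, hθI.1])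
        (by linarith [hϑ.1, hθI.2]) hk with h | h
      · rw [indicator_of_mem h]
        linarith [hnn (Ioc (ϑ + 2 * Real.pi - Real.pi / 2) (ϑ + 2 * Real.pi))]
      · rw [indicator_of_mem h]; linarith [hnn (Ioc (ϑ - Real.pi / 2) ϑ)]
  rw [integral_add h2.1 h3.1] at h4
  linarith [h2.2, h3.2]

/-- For small `lam`, the kernel is concentrated to the left of the normal. -/
theorem eventually_mem_of_kernel_ne_zero [hL : Fact (0 < L)] (hΓ : IsBoundaryParam C Γ)
    (hC : IsBody C) {t ϑ α β δ : ℝ} (hd : DifferentiableAt ℝ (curve Γ) t)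
    (h1 : ‖deriv (curve Γ) t‖ = 1) (h0 : height C (curve Γ t) ϑ = 0)
    (hϑ : ϑ ∈ Ioc α (α + 2 * Real.pi)) (hβ : β ≤ α + 2 * Real.pi) (hδ : 0 < δ)
    (hδ' : δ < Real.pi / 2) (hδα : δ < ϑ - α) :
    ∀ᶠ lam in 𝓝[>] (0 : ℝ), lam < height C (curve Γ t) (ϑ - δ) ∧
      ∀ θ ∈ Ioc α β, DifferentiableAt ℝ (fun t : ℝ => infHeight C t) θ →
        kernel C Γ lam t θ ≠ 0 → θ ∈ Ioc (ϑ - δ) ϑ := by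
  have hpi := Real.pi_pos
  have hmem := hΓ.mem_closure (t : AddCircle L)
  have hpos : 0 < height C (curve Γ t) (ϑ - δ) := by
    refine hΓ.height_pos_of_cos_lt_one hC hd h1 h0 ?_
    rw [sub_sub_cancel_left, Real.cos_neg, ← Real.cos_zero]
    exact Real.cos_lt_cos_of_nonneg_of_le_pi le_rfl (by linarith) hδ
  filter_upwards [Ioo_mem_nhdsGT hpos] with lam hlam
  refine ⟨hlam.2, fun θ hθI hθ hk => ?_⟩
  have hle : height C (curve Γ t) θ ≤ lam := by
    by_contra h
    rw [kernel, if_neg h] at hk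
    exact hk rfl
  have key : ∀ ψ, height C (curve Γ t) ψ = 0 →
      height C (curve Γ t) (ψ - δ) = height C (curve Γ t) (ϑ - δ) →
      θ ∈ Ioc (ψ - Real.pi / 2) ψ → ψ - δ < θ := by
    intro ψ hψ hψδ h
    by_contra hcon
    have := hC.antitoneOn_height hmem hψ ⟨h.1.le, h.2⟩ ⟨by linarith, by linarith⟩ (not_lt.1 hcon)
    change height C (curve Γ t) (ψ - δ) ≤ height C (curve Γ t) θ at this
    linarith [hlam.2]
  rcases hΓ.mem_of_kernel_ne_zero hC hd h1 h0 hθ (by linarith [hϑ.2, hθI.1])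
    (by linarith [hϑ.1, hθI.2]) hk with h | h
  · exact ⟨key ϑ h0 rfl h, h.2⟩
  -- The second copy is impossible: it would put θ beyond ϑ + 2π - δ > α + 2π ≥ β.
  · have := key (ϑ + 2 * Real.pi) (by rw [height_add_two_pi, h0])
      (by rw [add_sub_right_comm, height_add_two_pi]) h
    linarith [hθI.2]

/-- For small `lam` the kernel lives on (ϑ - δ, ϑ], where the cosine lies between cos δ and 1 and
the cut offset integrates to exactly `lam`. If ϑ ≤ β, this interval fits into (α, β]; if ϑ > β, it
misses it for small δ. -/
theorem tendsto_integral_kernel [hL : Fact (0 < L)] (hΓ : IsBoundaryParam C Γ) (hC : IsBody C)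
    {t : ℝ} (hd : DifferentiableAt ℝ (curve Γ) t) (h1 : ‖deriv (curve Γ) t‖ = 1)
    {α β : ℝ} (hβ : β ≤ α + 2 * Real.pi) :
    Tendsto (fun lam => 1 / lam * ∫ θ in Ioc α β, kernel C Γ lam t θ) (𝓝[>] 0)
      (𝓝 ({t | ∃ θ ∈ Ioc α β, height C (curve Γ t) θ = 0}.indicator (fun _ => (1 : ℝ)) t)) := by
  obtain ⟨ϑ, hϑ, h0⟩ := hΓ.exists_normal_mem_Ioc hC t α
  have hpi := Real.pi_pos
  have hmem := hΓ.mem_closure (t : AddCircle L)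
  by_cases hϑβ : ϑ ≤ β
  · rw [indicator_of_mem (show t ∈ {t | ∃ θ ∈ Ioc α β, height C (curve Γ t) θ = 0} from
      ⟨ϑ, ⟨hϑ.1, hϑβ⟩, h0⟩)]
    have key : ∀ δ, 0 < δ → δ < Real.pi / 2 → δ < ϑ - α → ∀ᶠ lam in 𝓝[>] (0 : ℝ),
        Real.cos δ ≤ 1 / lam * ∫ θ in Ioc α β, kernel C Γ lam t θ ∧
        1 / lam * ∫ θ in Ioc α β, kernel C Γ lam t θ ≤ 1 := by
      intro δ hδ hδ' hδα
      filter_upwards [hΓ.eventually_mem_of_kernel_ne_zero hC hd h1 h0 hϑ hβ hδ hδ' hδα,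
        self_mem_nhdsWithin] with lam hlam hlam0
      have hlam0 : 0 < lam := hlam0
      have he : ∫ θ in Ioc (ϑ - δ) ϑ, cutOffset C (curve Γ t) lam θ = lam := by
        obtain ⟨m, -, -, hm, he⟩ := hC.exists_integral_cutOffset_eq hmem h0 hlam0.le hδ.le hδ'.le
        exact he.trans (hm hlam.1.le)
      have hsub : Ioc (ϑ - δ) ϑ ⊆ Ioc α β := Ioc_subset_Ioc (by linarith) hϑβ
      have h2 : ∫ θ in Ioc α β, kernel C Γ lam t θ =
          ∫ θ in Ioc (ϑ - δ) ϑ, kernel C Γ lam t θ := by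
        refine setIntegral_eq_of_subset_of_ae_sdiff_eq_zero
          measurableSet_Ioc.nullMeasurableSet hsub ?_
        filter_upwards [hC.ae_differentiableAt] with θ hθ hθI
        by_contra hk
        exact hθI.2 (hlam.2 θ hθI.1 hθ hk)
      have hint := hΓ.integrableOn_kernel hC lam t (ϑ - δ) ϑ
      have hint' := hC.integrableOn_cutOffset hmem lam (ϑ - δ) ϑ
      have hup : ∫ θ in Ioc (ϑ - δ) ϑ, kernel C Γ lam t θ ≤ lam := by
        exact (setIntegral_mono hint hint' fun θ => hΓ.kernel_le_cutOffset lam t θ).trans_eq he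
      have hlow : Real.cos δ * lam ≤ ∫ θ in Ioc (ϑ - δ) ϑ, kernel C Γ lam t θ := by
        calc _ = ∫ θ in Ioc (ϑ - δ) ϑ, Real.cos δ * cutOffset C (curve Γ t) lam θ := by
              rw [integral_const_mul, he]
          _ ≤ _ := ?_
        refine setIntegral_mono_on (hint'.const_mul _) hint measurableSet_Ioc fun θ hθ => ?_
        rw [kernel_eq_cutOffset_mul, mul_comm, hΓ.tangSpeed_eq_cos hC hd h1 h0]
        refine mul_le_mul_of_nonneg_left (le_max_of_le_left ?_) (cutOffset_nonneg _ _ _ _)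
        rw [← Real.cos_neg (θ - ϑ)]
        exact Real.cos_le_cos_of_nonneg_of_le_pi (by linarith [hθ.2]) (by linarith)
          (by linarith [hθ.1])
      rw [h2, one_div_mul_eq_div, le_div_iff₀ hlam0, div_le_one hlam0]
      exact ⟨hlow, hup⟩
    have hδ0 : ∀ᶠ δ in 𝓝[>] (0 : ℝ), 0 < δ ∧ δ < Real.pi / 2 ∧ δ < ϑ - α := by
      filter_upwards [Ioo_mem_nhdsGT (show 0 < Real.pi / 2 by positivity),
        Ioo_mem_nhdsGT (sub_pos.2 hϑ.1)] with δ h2 h3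
      exact ⟨h2.1, h2.2, h3.2⟩
    refine tendsto_order.2 ⟨fun b hb => ?_, fun b hb => ?_⟩
    · have hcos : ∀ᶠ δ in 𝓝[>] (0 : ℝ), b < Real.cos δ := by
        refine ((Real.continuous_cos.tendsto 0).mono_left nhdsWithin_le_nhds).eventually_const_lt ?_
        rwa [Real.cos_zero]
      obtain ⟨δ, ⟨h2, h3, h4⟩, h5⟩ := (hδ0.and hcos).exists
      filter_upwards [key δ h2 h3 h4] with lam h
      exact h5.trans_le h.1
    · obtain ⟨δ, h2, h3, h4⟩ := hδ0.exists
      filter_upwards [key δ h2 h3 h4] with lam h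
      exact h.2.trans_lt hb
  · have hϑβ : β < ϑ := not_le.1 hϑβ
    obtain ⟨δ, ⟨hδ, hδ', hδα⟩, hδβ⟩ : ∃ δ, (0 < δ ∧ δ < Real.pi / 2 ∧ δ < ϑ - α) ∧ δ < ϑ - β := by
      have h2 : ∀ᶠ δ in 𝓝[>] (0 : ℝ), (0 < δ ∧ δ < Real.pi / 2 ∧ δ < ϑ - α) ∧ δ < ϑ - β := by
        filter_upwards [Ioo_mem_nhdsGT (show 0 < Real.pi / 2 by positivity),
          Ioo_mem_nhdsGT (sub_pos.2 hϑ.1), Ioo_mem_nhdsGT (sub_pos.2 hϑβ)] with δ h2 h3 h4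
        exact ⟨⟨h2.1, h2.2, h3.2⟩, h4.2⟩
      exact h2.exists
    have hnot : t ∉ {t | ∃ θ ∈ Ioc α β, height C (curve Γ t) θ = 0} := by
      rintro ⟨θ, hθ, hθ0⟩
      refine (hΓ.height_pos_of_cos_lt_one hC hd h1 h0 (θ := θ) ?_).ne' hθ0
      refine lt_of_le_of_ne (Real.cos_le_one _) fun h => ?_
      have := (Real.cos_eq_one_iff_of_lt_of_lt (x := θ - ϑ) (by linarith [hθ.1, hϑ.2])
        (by linarith [hθ.2])).1 h
      linarith [hθ.2]
    rw [indicator_of_notMem hnot]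
    refine tendsto_const_nhds.congr' ?_
    filter_upwards [hΓ.eventually_mem_of_kernel_ne_zero hC hd h1 h0 hϑ hβ hδ hδ' hδα] with lam hlam
    have h2 : ∫ θ in Ioc α β, kernel C Γ lam t θ = ∫ θ in Ioc α β, (0 : ℝ) := by
      refine setIntegral_congr_ae measurableSet_Ioc ?_
      filter_upwards [hC.ae_differentiableAt] with θ hθ hθI
      by_contra hk
      have := (hlam.2 θ hθI hθ hk).1
      linarith [hθI.2]
    rw [h2]
    simp

/-! ### Integration over the boundary and passage to the limit -/

theorem perimeterPortion_eq [hL : Fact (0 < L)] (hΓ : IsBoundaryParam C Γ) (hC : IsBody C)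
    (α β : ℝ) : perimeterPortion C Γ ((fun θ : ℝ => (θ : Real.Angle)) '' Ioc α β) =
      ∫ t in Ioc 0 L, {t | ∃ θ ∈ Ioc α β, height C (curve Γ t) θ = 0}.indicator
        (fun _ => (1 : ℝ)) t := by
  set S : Set (AddCircle L) :=
    {s | (normals C Γ s ∩ (fun θ : ℝ => (θ : Real.Angle)) '' Ioc α β).Nonempty} with hS
  have hpre : ((↑) : ℝ → AddCircle L) ⁻¹' S =
      {t | ∃ θ ∈ Ioc α β, height C (curve Γ t) θ = 0} := by
    ext t
    constructor
    · rintro ⟨_, h1, θ, hθ, rfl⟩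
      exact ⟨θ, hθ, sub_eq_zero.2 (Eq.symm h1)⟩
    · rintro ⟨θ, hθ, h⟩
      exact ⟨_, (sub_eq_zero.1 h).symm, θ, hθ, rfl⟩
  have hmp := AddCircle.measurePreserving_mk L 0
  rw [zero_add] at hmp
  have hSm : MeasurableSet S := by
    -- The half-open interval is exhausted by compact ones; for each of these, the set of parameters
    -- is the projection of a closed set along a compact factor, hence closed.
    have himg : S = ⋃ n : ℕ, {s : AddCircle L | ∃ θ ∈ Icc (α + 1 / ((n : ℝ) + 1)) β,
        (θ, s) ∈ {p : ℝ × AddCircle L | height C (Γ p.2) p.1 = 0}} := by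
      ext s
      simp only [mem_iUnion]
      constructor
      · rintro ⟨_, h1, θ, hθ, rfl⟩
        obtain ⟨n, hn⟩ := exists_nat_one_div_lt (sub_pos.2 hθ.1)
        exact ⟨n, θ, ⟨by linarith, hθ.2⟩, sub_eq_zero.2 (Eq.symm h1)⟩
      · rintro ⟨n, θ, hθ, h⟩
        have : (0 : ℝ) < 1 / ((n : ℝ) + 1) := by positivity
        exact ⟨_, (sub_eq_zero.1 h).symm, θ, ⟨by linarith [hθ.1], hθ.2⟩, rfl⟩
    rw [himg]
    refine MeasurableSet.iUnion fun n => (isClosed_setOf_exists_mem isCompact_Icc ?_).measurableSet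
    refine isClosed_eq ?_ continuous_const
    exact ((hΓ.continuous.comp continuous_snd).inner
      (continuous_u.comp continuous_fst)).sub (hC.continuous_infHeight.comp continuous_fst)
  change (volume S).toReal = _
  have hA := hmp.measurable hSm
  rw [hpre] at hA
  rw [← hmp.measure_preimage hSm.nullMeasurableSet, hpre, integral_indicator_const _ hA]
  simp [Measure.real]

theorem tendsto_integral_reach_sq [hL : Fact (0 < L)] (hΓ : IsBoundaryParam C Γ) (hC : IsBody C)
    {α β : ℝ} (hβ : β ≤ α + 2 * Real.pi) :
    Tendsto (fun lam => 1 / (2 * lam) * ∫ θ in Ioc α β, reach C θ lam ^ 2) (𝓝[>] 0)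
      (𝓝 (perimeterPortion C Γ ((fun θ : ℝ => (θ : Real.Angle)) '' Ioc α β))) := by
  obtain ⟨D, hD⟩ := hΓ.exists_kernel_bound hC
  rw [hΓ.perimeterPortion_eq hC]
  have h1 : Tendsto
      (fun lam => ∫ t in Ioc 0 L, 1 / lam * ∫ θ in Ioc α β, kernel C Γ lam t θ) (𝓝[>] 0)
      (𝓝 (∫ t in Ioc 0 L, {t | ∃ θ ∈ Ioc α β, height C (curve Γ t) θ = 0}.indicator
        (fun _ => (1 : ℝ)) t)) := by
    refine tendsto_integral_filter_of_dominated_convergence (fun _ => 2) ?_ ?_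
      (integrable_const _) ?_
    · refine Eventually.of_forall fun lam => ?_
      exact ((hΓ.measurable_kernel hC lam).stronglyMeasurable.integral_prod_right
        (ν := volume.restrict (Ioc α β))).aestronglyMeasurable.const_mul _
    · filter_upwards [self_mem_nhdsWithin] with lam hlam
      have hlam : 0 < lam := hlam
      filter_upwards [ae_restrict_of_ae hΓ.unitSpeed.ae_norm_deriv_eq_one] with t ht
      have h2 := hΓ.integral_kernel_le hC ht.1 ht.2 hβ hlam.le
      have h3 : 0 ≤ ∫ θ in Ioc α β, kernel C Γ lam t θ :=
        integral_nonneg fun θ => kernel_nonneg _ _ _ _ _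
      rw [Real.norm_eq_abs, abs_of_nonneg (by positivity), one_div_mul_eq_div, div_le_iff₀ hlam]
      exact h2
    · filter_upwards [ae_restrict_of_ae hΓ.unitSpeed.ae_norm_deriv_eq_one] with t ht
      exact hΓ.tendsto_integral_kernel hC ht.1 ht.2 hβ
  refine h1.congr' ?_
  filter_upwards [self_mem_nhdsWithin] with lam hlam
  have hlam : 0 < lam := hlam
  have hint : Integrable (Function.uncurry fun t θ => kernel C Γ lam t θ)
      ((volume.restrict (Ioc 0 L)).prod (volume.restrict (Ioc α β))) :=
    Integrable.of_bound (hΓ.measurable_kernel hC lam).aestronglyMeasurable D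
      (Eventually.of_forall fun p => hD _ _ _)
  have h2 : ∫ θ in Ioc α β, reach C θ lam ^ 2 / 2 =
      ∫ θ in Ioc α β, ∫ t in Ioc 0 L, kernel C Γ lam t θ := by
    refine setIntegral_congr_ae measurableSet_Ioc ?_
    filter_upwards [hC.ae_differentiableAt] with θ hθ _
    exact (hΓ.integral_kernel hC hθ hlam.le).symm
  rw [← integral_integral_swap hint, integral_div] at h2
  rw [integral_const_mul, ← h2]
  field_simp

end IsBoundaryParam

/-! ### Chords -/

/-- The point of given height `lam` and offset `y`. -/
def chordPt (C : Set Plane) (θ lam y : ℝ) : Plane :=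
  (infHeight C θ + lam) • u (θ : Real.Angle) +
    (deriv (fun t : ℝ => infHeight C t) θ - y) • u' (θ : Real.Angle)

@[simp] theorem height_chordPt (C : Set Plane) (θ lam y : ℝ) :
    height C (chordPt C θ lam y) θ = lam := by
  rw [height, chordPt, inner_smul_add_smul_u, add_sub_cancel_left]

@[simp] theorem offset_chordPt (C : Set Plane) (θ lam y : ℝ) :
    offset C (chordPt C θ lam y) θ = y := by
  rw [offset, chordPt, inner_smul_add_smul_u', sub_sub_cancel]

theorem eq_chordPt {a : Plane} {θ lam : ℝ} (h : height C a θ = lam) :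
    a = chordPt C θ lam (offset C a θ) :=
  eq_of_height_eq_of_offset_eq (C := C) (θ := θ) (by simp [h]) (by simp)

theorem chordPt_sub (C : Set Plane) (θ lam y z : ℝ) :
    chordPt C θ lam y - chordPt C θ lam z = (z - y) • u' (θ : Real.Angle) := by
  rw [chordPt, chordPt, add_sub_add_left_eq_sub, ← sub_smul, sub_sub_sub_cancel_left]

theorem norm_u' (θ : ℝ) : ‖u' (θ : Real.Angle)‖ = 1 := by
  have h1 := sq_inner_add_sq_inner (u' (θ : Real.Angle)) θ
  have h2 := inner_smul_add_smul_u 0 1 θ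
  have h3 := inner_smul_add_smul_u' 0 1 θ
  rw [zero_smul, one_smul, zero_add] at h2 h3
  rw [h2, h3] at h1
  nlinarith [norm_nonneg (u' (θ : Real.Angle))]

theorem isometry_chordPt (C : Set Plane) (θ lam : ℝ) : Isometry (chordPt C θ lam) := by
  refine Isometry.of_dist_eq fun y z => ?_
  rw [dist_eq_norm, chordPt_sub, norm_smul, norm_u', mul_one, Real.dist_eq, abs_sub_comm,
    Real.norm_eq_abs]

theorem length_image_chordPt (C : Set Plane) (θ lam : ℝ) (B : Set ℝ) :
    length (chordPt C θ lam '' B) = (volume B).toReal := by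
  rw [length, (isometry_chordPt C θ lam).hausdorffMeasure_image (Or.inl zero_le_one),
    hausdorffMeasure_real]

theorem chord_eq_image (C : Set Plane) (θ lam : ℝ) :
    chord C θ lam = chordPt C θ lam '' {y | chordPt C θ lam y ∈ C} := by
  ext a
  constructor
  · rintro ⟨ha, h⟩
    have h1 := eq_chordPt (C := C) (a := a) (θ := θ) (lam := lam) (by rw [height, h]; ring)
    exact ⟨offset C a θ, by rw [mem_ofPred_eq, ← h1]; exact ha, h1.symm⟩
  · rintro ⟨y, hy, rfl⟩
    have h1 := height_chordPt C θ lam y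
    rw [height, sub_eq_iff_eq_add'] at h1
    exact ⟨hy, h1⟩

/-- The tangential coordinates of the points of `C` at height `lam`. -/
def slice (C : Set Plane) (θ lam : ℝ) : Set ℝ :=
  (fun a => -inner ℝ a (u' (θ : Real.Angle))) '' {a | a ∈ closure C ∧ height C a θ = lam}

/-- The offset of the left end point of the chord. -/
def leftEnd (C : Set Plane) (θ lam : ℝ) : ℝ :=
  deriv (fun t : ℝ => infHeight C t) θ + sInf (slice C θ lam)

/-- The offset of the right end point of the chord. -/
def rightEnd (C : Set Plane) (θ lam : ℝ) : ℝ :=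
  deriv (fun t : ℝ => infHeight C t) θ + sSup (slice C θ lam)

namespace IsBody

/-- The witness lies on the segment from a contact point p to c. If the contact point has offset 0,
the last formula gives w an offset of order `lam`, which controls both chord ends. -/
theorem exists_interior_height_eq (hC : IsBody C) {c : Plane} (hc : c ∈ interior C) {θ lam : ℝ}
    (h0 : 0 < lam) (hlam : lam < height C c θ) :
    ∃ w ∈ interior C, height C w θ = lam ∧ ∃ p ∈ closure C, height C p θ = 0 ∧
      offset C w θ = lam / height C c θ * offset C c θ +
        (1 - lam / height C c θ) * offset C p θ := by
  obtain ⟨p, hp, hp0⟩ := hC.exists_height_eq_zero θ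
  have hH : 0 < height C c θ := h0.trans hlam
  refine ⟨(lam / height C c θ) • c + (1 - lam / height C c θ) • p,
    hC.convex.combo_interior_closure_mem_interior hc hp (by positivity)
      (sub_nonneg.2 ((div_le_one hH).2 hlam.le)) (by ring), ?_, p, hp, hp0, ?_⟩
  · rw [height_combo _ _ _ (by ring), hp0]
    field_simp
    ring
  · rw [offset_combo _ _ _ (by ring)]

theorem slice_eq_Icc (hC : IsBody C) {θ lam : ℝ} (hne : (slice C θ lam).Nonempty) :
    slice C θ lam = Icc (sInf (slice C θ lam)) (sSup (slice C θ lam)) := by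
  have hcomp : IsCompact (slice C θ lam) :=
    (hC.isCompact_closure.inter_right
      (isClosed_eq (continuous_height_left C θ) continuous_const)).image
        (continuous_id.inner continuous_const).neg
  have hconn : IsPreconnected (slice C θ lam) := by
    refine IsPreconnected.image (Convex.isPreconnected ?_) _
      (continuous_id.inner continuous_const).neg.continuousOn
    intro a ha b hb s t hs ht hst
    refine ⟨hC.convex.closure ha.1 hb.1 hs ht hst, ?_⟩
    rw [height_combo _ _ _ hst, ha.2, hb.2, ← add_mul, hst, one_mul]
  exact eq_Icc_csInf_csSup_of_connected_bdd_closed ⟨hne, hconn⟩ hcomp.bddBelow hcomp.bddAbove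
    hcomp.isClosed

theorem chordPt_mem_closure_iff (hC : IsBody C) {θ lam : ℝ} (hne : (slice C θ lam).Nonempty)
    (y : ℝ) : chordPt C θ lam y ∈ closure C ↔ y ∈ Icc (leftEnd C θ lam) (rightEnd C θ lam) := by
  have h1 : chordPt C θ lam y ∈ closure C ↔
      y - deriv (fun t : ℝ => infHeight C t) θ ∈ slice C θ lam := by
    constructor
    · intro h
      refine ⟨_, ⟨h, height_chordPt _ _ _ _⟩, ?_⟩
      have := offset_chordPt C θ lam y
      rw [offset] at this
      simp only
      linarith
    · rintro ⟨a, ⟨ha, h⟩, hay⟩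
      have h2 : offset C a θ = y := by
        rw [offset]
        simp only at hay
        linarith
      rw [← h2, ← eq_chordPt h]
      exact ha
  rw [h1, hC.slice_eq_Icc hne, leftEnd, rightEnd, mem_Icc, mem_Icc]
  constructor <;> rintro ⟨h2, h3⟩ <;> constructor <;> linarith

theorem slice_nonempty (hC : IsBody C) {c : Plane} (hc : c ∈ interior C) {θ lam : ℝ}
    (h0 : 0 < lam) (hlam : lam < height C c θ) : (slice C θ lam).Nonempty := by
  obtain ⟨w, hw, h, -⟩ := hC.exists_interior_height_eq hc h0 hlam
  exact ⟨_, w, ⟨subset_closure (interior_subset hw), h⟩, rfl⟩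

end IsBody

theorem chordPt_add (C : Set Plane) (θ lam y t : ℝ) :
    chordPt C θ lam (y + t) = chordPt C θ lam y + t • -u' (θ : Real.Angle) := by
  rw [← sub_eq_iff_eq_add', chordPt_sub, smul_neg, ← neg_smul]
  congr 1
  ring

/-- The chord of `C` in direction `u(θ)` at distance `lam` is nondegenerate. -/
structure IsChord (C : Set Plane) (θ lam : ℝ) : Prop where
  left_lt_right : leftEnd C θ lam < rightEnd C θ lam
  mem_closure_iff : ∀ y, chordPt C θ lam y ∈ closure C ↔
    y ∈ Icc (leftEnd C θ lam) (rightEnd C θ lam)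
  left_mem_frontier : chordPt C θ lam (leftEnd C θ lam) ∈ frontier C
  right_mem_frontier : chordPt C θ lam (rightEnd C θ lam) ∈ frontier C
  mem_interior : ∀ y ∈ Ioo (leftEnd C θ lam) (rightEnd C θ lam), chordPt C θ lam y ∈ interior C

theorem IsBody.isChord (hC : IsBody C) {c : Plane} (hc : c ∈ interior C) {θ lam : ℝ}
    (h0 : 0 < lam) (hlam : lam < height C c θ) : IsChord C θ lam := by
  have hmem := hC.chordPt_mem_closure_iff (hC.slice_nonempty hc h0 hlam)
  obtain ⟨w, hw, hwl, -⟩ := hC.exists_interior_height_eq hc h0 hlam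
  rw [eq_chordPt hwl] at hw
  set y := offset C w θ with hy
  have hyI := (hmem y).1 (subset_closure (interior_subset hw))
  have hlr := hyI.1.trans hyI.2
  have hr : chordPt C θ lam (rightEnd C θ lam) ∈ frontier C := by
    refine mem_frontier_of_forall_not_mem (v := -u' (θ : Real.Angle))
      ((hmem _).2 ⟨hlr, le_rfl⟩) fun t ht h => ?_
    rw [← chordPt_add, hmem] at h
    linarith [h.2]
  have hl : chordPt C θ lam (leftEnd C θ lam) ∈ frontier C := by
    refine mem_frontier_of_forall_not_mem (v := u' (θ : Real.Angle))
      ((hmem _).2 ⟨le_rfl, hlr⟩) fun t ht h => ?_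
    have h1 := chordPt_add C θ lam (leftEnd C θ lam) (-t)
    rw [neg_smul_neg] at h1
    rw [← h1, hmem] at h
    linarith [h.1]
  have hly : leftEnd C θ lam < y := lt_of_le_of_ne hyI.1 fun h => hl.2 (h ▸ hw)
  have hyr : y < rightEnd C θ lam := lt_of_le_of_ne hyI.2 fun h => hr.2 (h ▸ hw)
  have key : ∀ z x s : ℝ, chordPt C θ lam z ∈ closure C → 0 < s → s ≤ 1 →
      x = s * y + (1 - s) * z → chordPt C θ lam x ∈ interior C := by
    intro z x s hz hs hs1 hx
    have h1 := hC.convex.combo_interior_closure_mem_interior hw hz hs (sub_nonneg.2 hs1)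
      (by ring)
    have h2 : s • chordPt C θ lam y + (1 - s) • chordPt C θ lam z = chordPt C θ lam x := by
      refine eq_of_height_eq_of_offset_eq (C := C) (θ := θ) ?_ ?_
      · rw [height_combo _ _ _ (by ring), height_chordPt, height_chordPt, height_chordPt]; ring
      · rw [offset_combo _ _ _ (by ring)]; simp [hx]
    rwa [h2] at h1
  refine ⟨hly.trans hyr, hmem, hl, hr, fun x hx => ?_⟩
  rcases le_total x y with h | h
  · refine key (leftEnd C θ lam) x ((x - leftEnd C θ lam) / (y - leftEnd C θ lam))
      (frontier_subset_closure hl) (div_pos (sub_pos.2 hx.1) (sub_pos.2 hly))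
      ((div_le_one (sub_pos.2 hly)).2 (by linarith)) ?_
    have : y - leftEnd C θ lam ≠ 0 := (sub_pos.2 hly).ne'
    field_simp
    ring
  · refine key (rightEnd C θ lam) x ((rightEnd C θ lam - x) / (rightEnd C θ lam - y))
      (frontier_subset_closure hr) (div_pos (sub_pos.2 hx.2) (sub_pos.2 hyr))
      ((div_le_one (sub_pos.2 hyr)).2 (by linarith)) ?_
    have : rightEnd C θ lam - y ≠ 0 := (sub_pos.2 hyr).ne'
    field_simp
    ring

theorem eq_of_combo_eq_left {s t x y m : ℝ} (hs : 0 < s) (ht : 0 < t) (hst : s + t = 1)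
    (hx : m ≤ x) (hy : m ≤ y) (h : s * x + t * y = m) : x = m ∧ y = m := by
  have h1 := mul_nonneg hs.le (sub_nonneg.2 hx)
  have h2 := mul_nonneg ht.le (sub_nonneg.2 hy)
  have h3 : s * (x - m) + t * (y - m) = 0 := by linear_combination h - m * hst
  constructor
  · exact sub_eq_zero.1 ((mul_eq_zero.1 (by linarith : s * (x - m) = 0)).resolve_left hs.ne')
  · exact sub_eq_zero.1 ((mul_eq_zero.1 (by linarith : t * (y - m) = 0)).resolve_left ht.ne')

theorem eq_of_combo_eq_right {s t x y m : ℝ} (hs : 0 < s) (ht : 0 < t) (hst : s + t = 1)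
    (hx : x ≤ m) (hy : y ≤ m) (h : s * x + t * y = m) : x = m ∧ y = m := by
  obtain ⟨h1, h2⟩ := eq_of_combo_eq_left hs ht hst (neg_le_neg hx) (neg_le_neg hy)
    (by linear_combination -h)
  exact ⟨neg_injective h1, neg_injective h2⟩

namespace IsChord

variable {θ lam : ℝ}

theorem Ioo_subset (h : IsChord C θ lam) :
    Ioo (leftEnd C θ lam) (rightEnd C θ lam) ⊆ {y | chordPt C θ lam y ∈ C} :=
  fun y hy => (interior_subset (h.mem_interior y hy) : chordPt C θ lam y ∈ C)

theorem subset_Icc (h : IsChord C θ lam) :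
    {y | chordPt C θ lam y ∈ C} ⊆ Icc (leftEnd C θ lam) (rightEnd C θ lam) :=
  fun y hy => (h.mem_closure_iff y).1 (subset_closure hy)

theorem length_chord (h : IsChord C θ lam) :
    length (chord C θ lam) = rightEnd C θ lam - leftEnd C θ lam := by
  have h1 : volume {y | chordPt C θ lam y ∈ C} =
      ENNReal.ofReal (rightEnd C θ lam - leftEnd C θ lam) := by
    refine le_antisymm ((measure_mono h.subset_Icc).trans_eq Real.volume_Icc) ?_
    rw [← Real.volume_Ioo]
    exact measure_mono h.Ioo_subset
  rw [chord_eq_image, length_image_chordPt, h1,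
    ENNReal.toReal_ofReal (sub_nonneg.2 h.left_lt_right.le)]

theorem closure_chord (h : IsChord C θ lam) :
    closure (chord C θ lam) =
      chordPt C θ lam '' Icc (leftEnd C θ lam) (rightEnd C θ lam) := by
  rw [chord_eq_image, (isometry_chordPt C θ lam).isClosedEmbedding.closure_image_eq]
  congr 1
  refine subset_antisymm (closure_minimal h.subset_Icc isClosed_Icc) ?_
  rw [← closure_Ioo h.left_lt_right.ne]
  exact closure_mono h.Ioo_subset

/-- Two points of the closed chord whose offsets differ by its full length must be its ends. So the
choice made in `chordEnds` does not affect the end points. -/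
theorem isChordEnds_iff (h : IsChord C θ lam) (p : AddCircle L × AddCircle L) :
    IsChordEnds C Γ θ lam p ↔ Γ p.1 = chordPt C θ lam (leftEnd C θ lam) ∧
      Γ p.2 = chordPt C θ lam (rightEnd C θ lam) := by
  have hlr := h.left_lt_right
  unfold IsChordEnds
  rw [h.closure_chord, h.length_chord]
  constructor
  · rintro ⟨h1, h2, h3⟩
    obtain ⟨y, hy, hy'⟩ := extremePoints_subset h1
    obtain ⟨z, hz, hz'⟩ := extremePoints_subset h2
    rw [← hy', ← hz', chordPt_sub] at h3
    have h4 := congrArg norm h3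
    rw [norm_smul, norm_smul, norm_u', mul_one, mul_one, Real.norm_eq_abs, Real.norm_eq_abs,
      abs_of_pos (sub_pos.2 hlr)] at h4
    have h5 : z - y = rightEnd C θ lam - leftEnd C θ lam := by
      refine smul_left_injective ℝ (?_ : u' (θ : Real.Angle) ≠ 0) h3
      rw [← norm_pos_iff, norm_u']; exact one_pos
    have hyl : y = leftEnd C θ lam := by linarith [hy.1, hz.2]
    have hzr : z = rightEnd C θ lam := by linarith [hy.1, hz.2]
    rw [← hy', ← hz', hyl, hzr]
    exact ⟨rfl, rfl⟩
  · rintro ⟨h1, h2⟩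
    have hoff : ∀ {x₁ x₂ : Plane} {y₁ y₂ y s t : ℝ}, chordPt C θ lam y₁ = x₁ →
        chordPt C θ lam y₂ = x₂ → s + t = 1 → s • x₁ + t • x₂ = chordPt C θ lam y →
        s * y₁ + t * y₂ = y := by
      rintro x₁ x₂ y₁ y₂ y s t rfl rfl hst hx
      have := congrArg (fun a => offset C a θ) hx
      simpa [offset_combo _ _ _ hst] using this
    rw [h1, h2, chordPt_sub]
    refine ⟨mem_extremePoints.2 ⟨⟨_, ⟨le_rfl, hlr.le⟩, rfl⟩, ?_⟩,
      mem_extremePoints.2 ⟨⟨_, ⟨hlr.le, le_rfl⟩, rfl⟩, ?_⟩, rfl⟩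
    · rintro _ ⟨y₁, hy₁, rfl⟩ _ ⟨y₂, hy₂, rfl⟩ ⟨s, t, hs, ht, hst, hx⟩
      obtain ⟨e1, e2⟩ := eq_of_combo_eq_left hs ht hst hy₁.1 hy₂.1 (hoff rfl rfl hst hx)
      rw [e1, e2]
      exact ⟨rfl, rfl⟩
    · rintro _ ⟨y₁, hy₁, rfl⟩ _ ⟨y₂, hy₂, rfl⟩ ⟨s, t, hs, ht, hst, hx⟩
      obtain ⟨e1, e2⟩ := eq_of_combo_eq_right hs ht hst hy₁.2 hy₂.2 (hoff rfl rfl hst hx)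
      rw [e1, e2]
      exact ⟨rfl, rfl⟩

theorem apply_chordEnds (h : IsChord C θ lam) (hΓ : IsBoundaryParam C Γ) :
    Γ (sMinus C Γ θ lam) = chordPt C θ lam (leftEnd C θ lam) ∧
      Γ (sPlus C Γ θ lam) = chordPt C θ lam (rightEnd C θ lam) := by
  obtain ⟨s, hs⟩ := hΓ.exists_eq h.left_mem_frontier
  obtain ⟨t, ht⟩ := hΓ.exists_eq h.right_mem_frontier
  have hex : ∃ p, IsChordEnds C Γ θ lam p := ⟨(s, t), (h.isChordEnds_iff (s, t)).2 ⟨hs, ht⟩⟩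
  have hp := (h.isChordEnds_iff _).1 hex.choose_spec
  unfold sMinus sPlus chordEnds
  rw [dif_pos hex]
  exact hp

end IsChord

/-! ### The contact point and arcs of the boundary -/

theorem orderedDist_coe_add [hL : Fact (0 < L)] (t : ℝ) {d : ℝ} (hd : 0 ≤ d) (hdL : d < L) :
    orderedDist (t : AddCircle L) ((t + d : ℝ) : AddCircle L) = d := by
  refine IsLeast.csInf_eq ⟨⟨hd, by simp⟩, ?_⟩
  rintro e ⟨he, h⟩
  rw [← AddCircle.coe_add, eq_comm, ← sub_eq_zero, ← AddCircle.coe_sub,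
    AddCircle.coe_eq_zero_iff] at h
  obtain ⟨n, hn⟩ := h
  rw [zsmul_eq_mul] at hn
  by_contra hcon
  have h1 : (0 : ℝ) < n := by
    by_contra hn0
    have := mul_nonpos_of_nonpos_of_nonneg (not_lt.1 hn0) hL.out.le
    linarith
  have h2 : (1 : ℝ) ≤ n := by exact_mod_cast (by exact_mod_cast h1 : (0 : ℤ) < n)
  have := mul_le_mul_of_nonneg_right h2 hL.out.le
  linarith

theorem exists_lift_Ico [hL : Fact (0 < L)] (t : ℝ) (s : AddCircle L) :
    ∃ d, 0 ≤ d ∧ d < L ∧ s = ((t + d : ℝ) : AddCircle L) := by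
  obtain ⟨x, hx, rfl⟩ : s ∈ ((↑) : ℝ → AddCircle L) '' Ico t (t + L) := by
    rw [AddCircle.coe_image_Ico_eq]; exact mem_univ s
  exact ⟨x - t, sub_nonneg.2 hx.1, by linarith [hx.2], by simp⟩

theorem posArc_coe_add [hL : Fact (0 < L)] (t : ℝ) {d : ℝ} (hd : 0 ≤ d) (hdL : d < L) :
    posArc (t : AddCircle L) ((t + d : ℝ) : AddCircle L) =
      ((↑) : ℝ → AddCircle L) '' Icc t (t + d) := by
  ext s
  obtain ⟨e, he, heL, rfl⟩ := exists_lift_Ico t s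
  rw [posArc, mem_ofPred_eq, orderedDist_coe_add t hd hdL, orderedDist_coe_add t he heL]
  constructor
  · intro h
    exact ⟨t + e, ⟨by linarith, by linarith⟩, rfl⟩
  · rintro ⟨x, hx, hxe⟩
    have h1 : ((t + (x - t) : ℝ) : AddCircle L) = ((t + e : ℝ) : AddCircle L) := by
      rw [add_sub_cancel]; exact hxe
    have h2 := orderedDist_coe_add (L := L) t he heL
    rw [← h1, orderedDist_coe_add t (sub_nonneg.2 hx.1) (by linarith [hx.2])] at h2
    linarith [hx.2]

namespace IsBoundaryParam

/-- At an angle of differentiability the height along the boundary vanishes only at s₀, so by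
compactness it has a positive minimum off each open neighbourhood of s₀. -/
theorem tendsto_of_height_eq [hL : Fact (0 < L)] (hΓ : IsBoundaryParam C Γ) (hC : IsBody C)
    {θ : ℝ} (hθ : DifferentiableAt ℝ (fun t : ℝ => infHeight C t) θ) {s₀ : AddCircle L}
    (hs₀ : height C (Γ s₀) θ = 0) {F : ℝ → AddCircle L}
    (hF : ∀ᶠ lam in 𝓝[>] (0 : ℝ), height C (Γ (F lam)) θ = lam) :
    Tendsto F (𝓝[>] 0) (𝓝 s₀) := by
  have hcont : Continuous fun s => height C (Γ s) θ :=
    (continuous_height_left C θ).comp hΓ.continuous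
  rw [(nhds_basis_opens s₀).tendsto_right_iff]
  rintro U ⟨hsU, hU⟩
  rcases eq_empty_or_nonempty Uᶜ with he | hne
  · rw [compl_empty_iff] at he
    rw [he]; simp
  · obtain ⟨s, hs, hmin⟩ := hU.isClosed_compl.isCompact.exists_isMinOn hne hcont.continuousOn
    have hpos : 0 < height C (Γ s) θ := by
      refine lt_of_le_of_ne (hC.height_nonneg (hΓ.mem_closure s) θ) fun h => ?_
      have h1 := hC.offset_eq_zero hθ (hΓ.mem_closure s) h.symm
      have h2 := hC.offset_eq_zero hθ (hΓ.mem_closure s₀) hs₀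
      have h3 := hΓ.injective (eq_of_height_eq_of_offset_eq (h.symm.trans hs₀.symm)
        (h1.trans h2.symm))
      exact hs (h3 ▸ hsU)
    filter_upwards [hF, Ioo_mem_nhdsGT hpos] with lam h1 h2
    by_contra hcon
    have h3 : height C (Γ s) θ ≤ height C (Γ (F lam)) θ := hmin hcon
    linarith [h2.2]

/-- Both one-sided limits are the unique contact parameter, so the midpoint is too. Angles whose
supporting line contains an edge are not angles of differentiability and form a null set. -/
theorem sZero_eq [hL : Fact (0 < L)] (hΓ : IsBoundaryParam C Γ) (hC : IsBody C)
    {θ : ℝ} (hθ : DifferentiableAt ℝ (fun t : ℝ => infHeight C t) θ) {s₀ : AddCircle L}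
    (hs₀ : height C (Γ s₀) θ = 0) : sZero C Γ θ = s₀ := by
  obtain ⟨c, hc⟩ := hC.interior_nonempty
  have hch : ∀ᶠ lam in 𝓝[>] (0 : ℝ), IsChord C θ lam := by
    filter_upwards [Ioo_mem_nhdsGT (hC.height_pos hc θ)] with lam hlam
    exact hC.isChord hc hlam.1 hlam.2
  have h1 : sMinusZero C Γ θ = s₀ := by
    refine (hΓ.tendsto_of_height_eq hC hθ hs₀ ?_).limUnder_eq
    filter_upwards [hch] with lam h
    rw [(h.apply_chordEnds hΓ).1, height_chordPt]
  have h2 : sPlusZero C Γ θ = s₀ := by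
    refine (hΓ.tendsto_of_height_eq hC hθ hs₀ ?_).limUnder_eq
    filter_upwards [hch] with lam h
    rw [(h.apply_chordEnds hΓ).2, height_chordPt]
  obtain ⟨t, ht⟩ := QuotientAddGroup.mk_surjective s₀
  have h3 : orderedDist s₀ s₀ = 0 := by
    rw [← ht]
    have := orderedDist_coe_add (L := L) t le_rfl hL.out
    rwa [add_zero] at this
  rw [sZero, h1, h2, h3]
  simp

end IsBoundaryParam

/-! ### The right semi-chord -/

/-- A convex combination of c, p and q that gives positive weight to the interior point c is
interior. -/
theorem IsBody.one_le_add_of_frontier (hC : IsBody C) {c p q : Plane} (hc : c ∈ interior C)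
    (hp : p ∈ closure C) (hq : q ∈ closure C) {A B : ℝ} (hA : 0 ≤ A) (hB : 0 ≤ B)
    (h : (1 - A - B) • c + A • p + B • q ∈ frontier C) : 1 ≤ A + B := by
  by_contra! hlt
  have hA1 : 0 < 1 - A := by linarith
  have h1 := hC.convex.combo_interior_closure_mem_interior hc hq
    (a := (1 - A - B) / (1 - A)) (b := B / (1 - A)) (div_pos (by linarith) hA1)
    (by positivity) (by field_simp; ring)
  have h2 := hC.convex.combo_interior_closure_mem_interior h1 hp hA1 hA (by ring)
  refine h.2 ?_
  convert h2 using 1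
  rw [smul_add, smul_smul, smul_smul, mul_div_cancel₀ _ hA1.ne', mul_div_cancel₀ _ hA1.ne']
  abel

theorem inner_u_u (φ θ : ℝ) :
    inner ℝ (u (φ : Real.Angle)) (u (θ : Real.Angle)) = Real.cos (φ - θ) := by
  rw [inner_u, Real.cos_sub]
  simp [u]

theorem sin_sub_smul_u (x y z : ℝ) :
    Real.sin (z - x) • u (y : Real.Angle) =
      Real.sin (z - y) • u (x : Real.Angle) + Real.sin (y - x) • u (z : Real.Angle) := by
  ext i
  simp only [u, PiLp.add_apply, PiLp.smul_apply, smul_eq_mul, Real.Angle.cos_coe,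
    Real.Angle.sin_coe, Real.sin_sub]
  fin_cases i
  · simp only [Fin.zero_eta, Matrix.cons_val_zero]; ring
  · simp only [Fin.mk_one, Matrix.cons_val_one, Matrix.cons_val_fin_one]; ring

/-- The cross product of the vectors from c to the contact point and to the right chord end is r₀ r₁
sin d = R H - lam X ≥ 0. Equality would mean d = π, that is opposite rays, but both points lie below
c. The arc between them thus subtends less than π at c. -/
theorem sin_pos_of_cross {r₀ r₁ a d H lam X R : ℝ} (hr₀ : 0 < r₀) (hr₁ : 0 < r₁) (hd : 0 < d)
    (hd' : d < 2 * Real.pi) (h₀ : r₀ * Real.cos a = -H) (h₀' : r₀ * Real.sin a = X)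
    (h₁ : r₁ * Real.cos (a + d) = lam - H) (h₁' : r₁ * Real.sin (a + d) = X - R)
    (hH : 0 < H) (hlam : lam < H) (hW : lam * X ≤ R * H) : 0 < Real.sin d := by
  have h1 : r₀ * r₁ * Real.sin d = R * H - lam * X := by
    have : Real.sin d = Real.sin (a + d) * Real.cos a - Real.cos (a + d) * Real.sin a := by
      rw [← Real.sin_sub, add_sub_cancel_left]
    rw [this]
    linear_combination (r₁ * Real.sin (a + d)) * h₀ - (r₁ * Real.cos (a + d)) * h₀' +
      (-H) * h₁' - X * h₁
  have h2 : 0 ≤ Real.sin d := by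
    by_contra! h
    have := mul_neg_of_pos_of_neg (mul_pos hr₀ hr₁) h
    linarith
  refine lt_of_le_of_ne h2 fun h => ?_
  have hpi : d = Real.pi := by
    by_contra hne
    have := (Real.sin_eq_zero_iff_of_lt_of_lt (x := d - Real.pi) (by linarith)
      (by linarith)).1 (by rw [Real.sin_sub_pi, ← h, neg_zero])
    exact hne (by linarith)
  rw [hpi, Real.cos_add_pi] at h₁
  have hc : Real.cos a < 0 := by
    by_contra! h
    have := mul_nonneg hr₀.le h
    linarith
  have := mul_pos hr₁ (neg_pos.2 hc)
  linarith

namespace IsBoundaryParam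

/-- On the positive arc from a contact point to a boundary point at height `lam` on the right end
of the chord, the offset is at least the minimum of the offsets of the end points. -/
theorem min_le_offset (hΓ : IsBoundaryParam C Γ) (hC : IsBody C)
    {c : Plane} (hc : c ∈ interior C) {φ : ℝ → ℝ} (hmono : StrictMono φ)
    (hper : ∀ t, φ (t + L) = φ t + 2 * Real.pi)
    (hpol : ∀ t : ℝ, ∃ r : ℝ, 0 < r ∧ curve Γ t = c + r • u (φ t : Real.Angle))
    {θ lam t₀ d : ℝ} (h0 : 0 < lam) (hlam : lam < height C c θ)
    (hd : 0 ≤ d) (hdL : d < L) (ht₀ : height C (curve Γ t₀) θ = 0)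
    (ht₀' : offset C (curve Γ t₀) θ = 0) (ht₁ : height C (curve Γ (t₀ + d)) θ = lam)
    (hW : lam * offset C c θ ≤ offset C (curve Γ (t₀ + d)) θ * height C c θ)
    {t : ℝ} (ht : t ∈ Icc t₀ (t₀ + d)) :
    min 0 (offset C (curve Γ (t₀ + d)) θ) ≤ offset C (curve Γ t) θ := by
  obtain ⟨r₀, hr₀, e₀⟩ := hpol t₀
  obtain ⟨r₁, hr₁, e₁⟩ := hpol (t₀ + d)
  obtain ⟨r, hr, e⟩ := hpol t
  set H := height C c θ with hH
  set X := offset C c θ with hX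
  set R := offset C (curve Γ (t₀ + d)) θ with hR
  have hd0 : 0 < d := by
    refine lt_of_le_of_ne hd fun h => ?_
    rw [← h, add_zero, ht₀] at ht₁
    exact h0.ne ht₁
  have hpolar : ∀ ρ ψ : ℝ, height C (c + ρ • u (ψ : Real.Angle)) θ = H + ρ * Real.cos (ψ - θ) ∧
      offset C (c + ρ • u (ψ : Real.Angle)) θ = X - ρ * Real.sin (ψ - θ) := by
    intro ρ ψ
    have h2 : inner ℝ (u (ψ : Real.Angle)) (u' (θ : Real.Angle)) = Real.sin (ψ - θ) := by
      rw [inner_u', Real.sin_sub]; simp [u]; ring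
    rw [hH, hX, height, height, offset, offset, inner_add_left, inner_add_left, inner_smul_left,
      inner_smul_left, inner_u_u, h2]
    simp only [conj_trivial]
    constructor <;> ring
  have hφd : φ t₀ < φ (t₀ + d) := hmono (by linarith)
  have hφd' : φ (t₀ + d) < φ t₀ + 2 * Real.pi := by
    rw [← hper]; exact hmono (by linarith)
  have hsum : φ t₀ - θ + (φ (t₀ + d) - φ t₀) = φ (t₀ + d) - θ := by ring
  have hH0 : 0 < H := h0.trans hlam
  have hsin : 0 < Real.sin (φ (t₀ + d) - φ t₀) := by
    have q₀ := hpolar r₀ (φ t₀)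
    have q₁ := hpolar r₁ (φ (t₀ + d))
    rw [← e₀, ht₀, ht₀'] at q₀
    rw [← e₁, ht₁, ← hR] at q₁
    refine sin_pos_of_cross hr₀ hr₁ (sub_pos.2 hφd) (by linarith) (a := φ t₀ - θ) (H := H)
      (X := X) (R := R) (lam := lam) ?_ ?_ ?_ ?_ hH0 hlam hW
    · linarith [q₀.1]
    · linarith [q₀.2]
    · rw [hsum]; linarith [q₁.1]
    · rw [hsum]; linarith [q₁.2]
  have hpi : φ (t₀ + d) - φ t₀ < Real.pi := by
    by_contra! h
    have := Real.sin_nonpos_of_nonpos_of_neg_pi_le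
      (x := φ (t₀ + d) - φ t₀ - 2 * Real.pi) (by linarith) (by linarith)
    rw [Real.sin_sub_two_pi] at this
    linarith
  have hφ₀ := hmono.monotone ht.1
  have hφ₁ := hmono.monotone ht.2
  set S := Real.sin (φ (t₀ + d) - φ t₀) with hS
  -- A and B are the coefficients of Γ(t) - c in the basis Γ(t₀) - c, Γ(t₀ + d) - c. They are
  -- nonnegative because the polar angle of Γ(t) lies between the other two, less than π apart.
  set A := r * Real.sin (φ (t₀ + d) - φ t) / (r₀ * S) with hA
  set B := r * Real.sin (φ t - φ t₀) / (r₁ * S) with hB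
  have hA0 : 0 ≤ A := div_nonneg (mul_nonneg hr.le
    (Real.sin_nonneg_of_nonneg_of_le_pi (by linarith) (by linarith))) (by positivity)
  have hB0 : 0 ≤ B := div_nonneg (mul_nonneg hr.le
    (Real.sin_nonneg_of_nonneg_of_le_pi (by linarith) (by linarith))) (by positivity)
  have hq : curve Γ t = (1 - A - B) • c + A • curve Γ t₀ + B • curve Γ (t₀ + d) := by
    have h1 := sin_sub_smul_u (φ t₀) (φ t) (φ (t₀ + d))
    have h2 : r • u (φ t : Real.Angle) =
        (A * r₀) • u (φ t₀ : Real.Angle) + (B * r₁) • u (φ (t₀ + d) : Real.Angle) := by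
      have h3 : A * r₀ = r / S * Real.sin (φ (t₀ + d) - φ t) := by rw [hA]; field_simp
      have h4 : B * r₁ = r / S * Real.sin (φ t - φ t₀) := by rw [hB]; field_simp
      rw [h3, h4, mul_smul, mul_smul, ← smul_add, ← h1, smul_smul, ← hS,
        div_mul_cancel₀ _ hsin.ne']
    rw [e, e₀, e₁, h2, smul_add, smul_add, smul_smul, smul_smul, sub_smul, sub_smul, one_smul]
    abel
  have hAB : 1 ≤ A + B := by
    refine hC.one_le_add_of_frontier hc (hΓ.mem_closure (t₀ : AddCircle L))
      (hΓ.mem_closure ((t₀ + d : ℝ) : AddCircle L)) hA0 hB0 ?_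
    have := hΓ.mem_frontier (t : AddCircle L)
    change curve Γ t ∈ frontier C at this
    rw [hq] at this
    exact this
  have hz : height C (curve Γ t) θ = H * (1 - A - B) + B * lam := by
    have h1 : height C (curve Γ t) θ = (1 - A - B) * H + A * height C (curve Γ t₀) θ +
        B * height C (curve Γ (t₀ + d)) θ := by
      rw [hq]
      simp only [hH, height, inner_add_left, inner_smul_left, conj_trivial]
      ring
    rw [h1, ht₀, ht₁]; ring
  have hx : offset C (curve Γ t) θ = X * (1 - A - B) + B * R := by
    have h1 : offset C (curve Γ t) θ = (1 - A - B) * X + A * offset C (curve Γ t₀) θ +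
        B * offset C (curve Γ (t₀ + d)) θ := by
      rw [hq]
      simp only [hX, offset, inner_add_left, inner_smul_left, conj_trivial]
      ring
    rw [h1, ht₀', ← hR]; ring
  have hz0 : 0 ≤ H * (1 - A - B) + B * lam := hz ▸ hC.height_nonneg (hΓ.mem_closure _) θ
  rw [hx]
  have hk : 0 ≤ A + B - 1 := by linarith
  rcases le_total 0 R with hR0 | hR0
  · rw [min_eq_left hR0]
    -- The expression equals R · height(Γ(t)) + (A + B - 1)(R H - lam X), a sum of nonnegative
    -- terms.
    have h1 : 0 ≤ lam * (X * (1 - A - B) + B * R) := by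
      nlinarith [mul_nonneg hR0 hz0, mul_nonneg hk (sub_nonneg.2 hW)]
    exact nonneg_of_mul_nonneg_right h1 h0
  · rw [min_eq_right hR0]
    -- From lam X ≤ R H ≤ R lam, since R ≤ 0 and H > lam. The offset minus R is then (A + B - 1)(R -
    -- X) - A R.
    have h1 : X ≤ R := by
      have : lam * X ≤ lam * R := by nlinarith
      exact le_of_mul_le_mul_left this h0
    nlinarith [mul_nonneg hA0 (neg_nonneg.2 hR0), mul_nonneg hk (sub_nonneg.2 h1)]

/-- The arc starts at offset 0 and ends at the right chord end, so its projection covers all offsets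
between them by the intermediate value theorem, and `min_le_offset` rules out anything to the left.
The `max` and `min` handle chords lying wholly on one side of the contact point. -/
theorem length_rightSemiChord [hL : Fact (0 < L)] (hΓ : IsBoundaryParam C Γ) (hC : IsBody C)
    {c : Plane} (hc : c ∈ interior C) {φ : ℝ → ℝ} (hmono : StrictMono φ)
    (hper : ∀ t, φ (t + L) = φ t + 2 * Real.pi)
    (hpol : ∀ t : ℝ, ∃ r : ℝ, 0 < r ∧ curve Γ t = c + r • u (φ t : Real.Angle))
    {θ lam : ℝ} (hθ : DifferentiableAt ℝ (fun t : ℝ => infHeight C t) θ)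
    (h0 : 0 < lam) (hlam : lam < height C c θ) :
    length (rightSemiChord C Γ θ lam) =
      rightEnd C θ lam - max (leftEnd C θ lam) (min 0 (rightEnd C θ lam)) := by
  have hch := hC.isChord hc h0 hlam
  obtain ⟨p, hp, hp0⟩ := hC.exists_height_eq_zero θ
  obtain ⟨t₀, -, rfl⟩ := hΓ.exists_mem_Ioc (hC.frontier_of_height_eq_zero hp hp0)
  have hoff := hC.offset_eq_zero hθ hp hp0
  have hs₀ : sZero C Γ θ = (t₀ : AddCircle L) := hΓ.sZero_eq hC hθ hp0
  obtain ⟨d, hd, hdL, hs₁⟩ := exists_lift_Ico t₀ (sPlus C Γ θ lam)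
  have hend : curve Γ (t₀ + d) = chordPt C θ lam (rightEnd C θ lam) := by
    rw [← (hch.apply_chordEnds hΓ).2, hs₁]; rfl
  have hR : offset C (curve Γ (t₀ + d)) θ = rightEnd C θ lam := by rw [hend, offset_chordPt]
  have hW : lam * offset C c θ ≤ offset C (curve Γ (t₀ + d)) θ * height C c θ := by
    obtain ⟨w, hw, hwl, q, hq, hq0, hwo⟩ := hC.exists_interior_height_eq hc h0 hlam
    rw [hC.offset_eq_zero hθ hq hq0, mul_zero, add_zero] at hwo
    rw [eq_chordPt hwl] at hw
    have h1 := ((hch.mem_closure_iff _).1 (subset_closure (interior_subset hw))).2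
    rw [hwo, ← hR, div_mul_eq_mul_div, div_le_iff₀ (h0.trans hlam)] at h1
    exact h1
  have hmin : ∀ t ∈ Icc t₀ (t₀ + d), min 0 (rightEnd C θ lam) ≤ offset C (curve Γ t) θ := by
    intro t ht
    have := hΓ.min_le_offset hC hc hmono hper hpol h0 hlam hd hdL hp0 hoff
      (by rw [hend, height_chordPt]) hW ht
    rwa [hR] at this
  have hsemi : rightSemiChord C Γ θ lam = chordPt C θ lam '' {y | chordPt C θ lam y ∈ C ∧
      ∃ t ∈ Icc t₀ (t₀ + d), offset C (curve Γ t) θ = y} := by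
    rw [rightSemiChord, hs₀, hs₁, posArc_coe_add t₀ hd hdL, chord_eq_image]
    ext x
    constructor
    · rintro ⟨⟨y, hy, rfl⟩, _, ⟨t, ht, rfl⟩, r, hr⟩
      refine ⟨y, ⟨hy, t, ht, ?_⟩, rfl⟩
      change curve Γ t = _ at hr
      have e1 : inner ℝ (u (θ : Real.Angle)) (u' (θ : Real.Angle)) = (0 : ℝ) := by
        have := inner_smul_add_smul_u' 1 0 θ; simpa using this
      rw [← offset_chordPt C θ lam y, hr, offset, offset, inner_add_left, inner_smul_left, e1,
        mul_zero, add_zero]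
    · rintro ⟨y, ⟨hy, t, ht, rfl⟩, rfl⟩
      refine ⟨⟨_, hy, rfl⟩, _, ⟨t, ht, rfl⟩, height C (curve Γ t) θ - lam, ?_⟩
      change curve Γ t = _
      have e2 : inner ℝ (u (θ : Real.Angle)) (u (θ : Real.Angle)) = (1 : ℝ) := by
        have := inner_smul_add_smul_u 1 0 θ; simpa using this
      have e1 : inner ℝ (u (θ : Real.Angle)) (u' (θ : Real.Angle)) = (0 : ℝ) := by
        have := inner_smul_add_smul_u' 1 0 θ; simpa using this
      refine eq_of_height_eq_of_offset_eq (C := C) (θ := θ) ?_ ?_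
      · have h1 := height_chordPt C θ lam (offset C (curve Γ t) θ)
        rw [height] at h1
        conv_rhs => rw [height, inner_add_left, inner_smul_left, e2, conj_trivial]
        linarith
      · have h1 := offset_chordPt C θ lam (offset C (curve Γ t) θ)
        rw [offset] at h1
        conv_rhs => rw [offset, inner_add_left, inner_smul_left, e1]
        linarith
  set l := leftEnd C θ lam with hl
  set R := rightEnd C θ lam with hRdef
  set m := max l (min 0 R) with hm
  have hmR : m ≤ R := max_le hch.left_lt_right.le (min_le_right _ _)
  have hvol : volume {y | chordPt C θ lam y ∈ C ∧
      ∃ t ∈ Icc t₀ (t₀ + d), offset C (curve Γ t) θ = y} = ENNReal.ofReal (R - m) := by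
    refine le_antisymm ?_ ?_
    · rw [← Real.volume_Icc]
      refine measure_mono ?_
      rintro _ ⟨hy, t, ht, rfl⟩
      have h1 := hch.subset_Icc hy
      exact ⟨max_le h1.1 (hmin t ht), h1.2⟩
    · rw [← Real.volume_Ioo]
      refine measure_mono fun y hy => ⟨hch.Ioo_subset
        ⟨(le_max_left _ _).trans_lt hy.1, hy.2⟩, ?_⟩
      have hcont : ContinuousOn (fun t => offset C (curve Γ t) θ) (uIcc t₀ (t₀ + d)) :=
        ((continuous_offset C θ).comp hΓ.lipschitzWith.continuous).continuousOn
      have h1 := intermediate_value_uIcc hcont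
      simp only [hoff, hR] at h1
      have h2 : y ∈ uIcc 0 R := by
        rw [mem_uIcc]
        have h3 := (le_max_right _ _).trans_lt hy.1
        rcases le_total 0 R with h | h
        · rw [min_eq_left h] at h3
          exact Or.inl ⟨h3.le, hy.2.le⟩
        · rw [min_eq_right h] at h3
          exact absurd hy.2 h3.not_gt
      obtain ⟨t, ht, hty⟩ := h1 h2
      rw [uIcc_of_le (by linarith)] at ht
      exact ⟨t, ht, hty⟩
  rw [hsemi, length_image_chordPt, hvol, ENNReal.toReal_ofReal (sub_nonneg.2 hmR)]

end IsBoundaryParam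

/-! ### Comparison of the chord ends with the reach -/

theorem IsBody.reach_le_rightEnd_add (hC : IsBody C) {c : Plane} (hc : c ∈ interior C)
    {θ lam D : ℝ} (hD : ∀ a ∈ closure C, |offset C a θ| ≤ D)
    (h0 : 0 < lam) (hlam : lam < height C c θ) :
    reach C θ lam ≤ rightEnd C θ lam + lam / height C c θ * (2 * D) := by
  have hch := hC.isChord hc h0 hlam
  obtain ⟨p, hp, hp0⟩ := hC.exists_height_eq_zero θ
  refine csSup_le ⟨_, p, ⟨hp, hp0.trans_le h0.le⟩, rfl⟩ ?_
  rintro _ ⟨a, ⟨ha, hal⟩, rfl⟩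
  have hz := hC.height_nonneg ha θ
  have hDa := abs_le.1 (hD a ha)
  have hDc := abs_le.1 (hD c (subset_closure (interior_subset hc)))
  set H := height C c θ with hH
  set z := height C a θ with hzdef
  have hHz : 0 < H - z := by linarith
  -- Moving a towards c by this fraction brings it to height `lam`. The fraction is at most lam / H,
  -- and the offset changes by at most 2D times it.
  set s := (lam - z) / (H - z) with hs
  have hs0 : 0 ≤ s := div_nonneg (by linarith) hHz.le
  have hs1 : s ≤ 1 := (div_le_one hHz).2 (by linarith)
  have hsl : s ≤ lam / H := by
    rw [hs, div_le_div_iff₀ hHz (h0.trans hlam)]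
    nlinarith
  have hmem : (1 - s) • a + s • c ∈ closure C :=
    hC.convex.closure ha (subset_closure (interior_subset hc)) (by linarith) hs0 (by ring)
  have hheight : height C ((1 - s) • a + s • c) θ = lam := by
    rw [height_combo _ _ _ (by ring), ← hH, ← hzdef, hs]
    field_simp
    ring
  rw [eq_chordPt hheight, hch.mem_closure_iff, offset_combo _ _ _ (by ring)] at hmem
  have h1 : s * (2 * D) ≤ lam / H * (2 * D) := mul_le_mul_of_nonneg_right hsl (by linarith)
  have h2 : s * (offset C a θ - offset C c θ) ≤ s * (2 * D) :=
    mul_le_mul_of_nonneg_left (by linarith) hs0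
  have h3 := hmem.2
  change offset C a θ ≤ _
  linarith

/-- The segment from the contact point to c meets the chord at an offset of order `lam`, so even a
chord lying wholly to the right starts near 0. -/
theorem IsBody.leftEnd_le (hC : IsBody C) {c : Plane} (hc : c ∈ interior C)
    {θ lam D : ℝ} (hθ : DifferentiableAt ℝ (fun t : ℝ => infHeight C t) θ)
    (hD : ∀ a ∈ closure C, |offset C a θ| ≤ D) (h0 : 0 < lam) (hlam : lam < height C c θ) :
    leftEnd C θ lam ≤ lam / height C c θ * D := by
  have hch := hC.isChord hc h0 hlam
  obtain ⟨w, hw, hwl, q, hq, hq0, hwo⟩ := hC.exists_interior_height_eq hc h0 hlam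
  rw [hC.offset_eq_zero hθ hq hq0, mul_zero, add_zero] at hwo
  rw [eq_chordPt hwl] at hw
  have h1 := ((hch.mem_closure_iff _).1 (subset_closure (interior_subset hw))).1
  rw [hwo] at h1
  refine h1.trans (mul_le_mul_of_nonneg_left
    (abs_le.1 (hD c (subset_closure (interior_subset hc)))).2 ?_)
  exact div_nonneg h0.le (h0.trans hlam).le

theorem IsBody.rightEnd_le_reach (hC : IsBody C) {θ lam : ℝ} (hch : IsChord C θ lam) :
    rightEnd C θ lam ≤ reach C θ lam := by
  have := hC.offset_le_reach (θ := θ) (lam := lam)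
    ((hch.mem_closure_iff _).2 ⟨hch.left_lt_right.le, le_rfl⟩) (height_chordPt _ _ _ _).le
  rwa [offset_chordPt] at this

/-! ### Measurability -/

/-- The supremum is attained, so its superlevel sets are projections of closed sets along the
compact K, hence closed. -/
theorem measurable_sSup_image {K : Set Plane} (hK : IsCompact K) {f : Plane × ℝ → ℝ}
    (hf : Continuous f) {Z : Set (Plane × ℝ)} (hZ : IsClosed Z)
    (hne : ∀ θ, ∃ a ∈ K, (a, θ) ∈ Z) :
    Measurable fun θ => sSup ((fun a => f (a, θ)) '' {a | a ∈ K ∧ (a, θ) ∈ Z}) := by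
  refine measurable_of_Ici fun q => ?_
  have h1 : (fun θ => sSup ((fun a => f (a, θ)) '' {a | a ∈ K ∧ (a, θ) ∈ Z})) ⁻¹' Ici q =
      {θ | ∃ a ∈ K, (a, θ) ∈ Z ∩ {p | q ≤ f p}} := by
    ext θ
    have hcomp : IsCompact ((fun a => f (a, θ)) '' {a | a ∈ K ∧ (a, θ) ∈ Z}) :=
      (hK.inter_right (hZ.preimage (by fun_prop : Continuous fun a : Plane => (a, θ)))).image
        (hf.comp (by fun_prop))
    obtain ⟨a, ha, haZ⟩ := hne θ
    constructor
    · intro h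
      obtain ⟨b, hb, hbe⟩ := hcomp.sSup_mem ⟨_, a, ⟨ha, haZ⟩, rfl⟩
      exact ⟨b, hb.1, hb.2, (show q ≤ _ from h).trans_eq hbe.symm⟩
    · rintro ⟨b, hb, hbZ, hq⟩
      exact (show q ≤ f (b, θ) from hq).trans (le_csSup hcomp.bddAbove ⟨b, ⟨hb, hbZ⟩, rfl⟩)
  rw [h1]
  exact (isClosed_setOf_exists_mem hK
    (hZ.inter (isClosed_le continuous_const hf))).measurableSet

theorem IsBody.measurable_ends (hC : IsBody C) {c : Plane} (hc : c ∈ interior C) {lam : ℝ}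
    (h0 : 0 < lam) (hlam : ∀ θ, lam < height C c θ) :
    Measurable (fun θ => leftEnd C θ lam) ∧ Measurable (fun θ => rightEnd C θ lam) := by
  have hf : Continuous fun p : Plane × ℝ => inner ℝ p.1 (u' (p.2 : Real.Angle)) :=
    continuous_fst.inner (continuous_u'.comp continuous_snd)
  have hZ : IsClosed {p : Plane × ℝ | height C p.1 p.2 = lam} :=
    isClosed_eq hC.continuous_height continuous_const
  have hne : ∀ θ, ∃ a ∈ closure C, (a, θ) ∈ {p : Plane × ℝ | height C p.1 p.2 = lam} := by
    intro θ
    obtain ⟨w, hw, h, -⟩ := hC.exists_interior_height_eq hc h0 (hlam θ)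
    exact ⟨w, subset_closure (interior_subset hw), h⟩
  refine ⟨(measurable_deriv _).add ?_, (measurable_deriv _).add
    (measurable_sSup_image hC.isCompact_closure hf.neg hZ hne)⟩
  convert (measurable_sSup_image hC.isCompact_closure hf hZ hne).neg using 1
  ext θ
  rw [Real.sInf_def, slice, ← image_neg_eq_neg, image_image]
  simp only [neg_neg]
  rfl

namespace IsBoundaryParam

theorem aestronglyMeasurable_reach [hL : Fact (0 < L)] (hΓ : IsBoundaryParam C Γ)
    (hC : IsBody C) {lam : ℝ} (hlam : 0 ≤ lam) :
    AEStronglyMeasurable (fun θ => reach C θ lam) volume := by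
  have h1 : StronglyMeasurable fun θ => ∫ t in Ioc 0 L, kernel C Γ lam t θ :=
    StronglyMeasurable.integral_prod_right (f := fun θ t => kernel C Γ lam t θ)
      ((hΓ.measurable_kernel hC lam).comp measurable_swap).stronglyMeasurable
  have h2 : Measurable fun θ => √(2 * ∫ t in Ioc 0 L, kernel C Γ lam t θ) :=
    (h1.measurable.const_mul 2).sqrt
  refine h2.aestronglyMeasurable.congr ?_
  filter_upwards [hC.ae_differentiableAt] with θ hθ
  rw [hΓ.integral_kernel hC hθ hlam, mul_div_cancel₀ _ two_ne_zero,
    Real.sqrt_sq (hC.reach_nonneg hθ hlam)]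

end IsBoundaryParam

theorem IsBody.reach_le (hC : IsBody C) {θ lam D : ℝ}
    (hD : ∀ a ∈ closure C, |offset C a θ| ≤ D) (hlam : 0 ≤ lam) : reach C θ lam ≤ D := by
  obtain ⟨p, hp, hp0⟩ := hC.exists_height_eq_zero θ
  refine csSup_le ⟨_, p, ⟨hp, hp0.trans_le hlam⟩, rfl⟩ ?_
  rintro _ ⟨a, ha, rfl⟩
  exact (abs_le.1 (hD a ha.1)).2

/-- The length of the right semi-chord agrees with the reach up to an error of order `lam`. -/
theorem IsBoundaryParam.exists_length_bounds [hL : Fact (0 < L)] (hΓ : IsBoundaryParam C Γ)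
    (hC : IsBody C) : ∃ ρ > 0, ∃ K > 0, ∀ lam ∈ Ioo 0 ρ,
      AEStronglyMeasurable (fun θ : ℝ => length (rightSemiChord C Γ θ lam)) volume ∧
      ∀ θ : ℝ, DifferentiableAt ℝ (fun t : ℝ => infHeight C t) θ →
        length (rightSemiChord C Γ θ lam) ≤ reach C θ lam ∧
        reach C θ lam ≤ length (rightSemiChord C Γ θ lam) + K * lam := by
  obtain ⟨c, hc, φ, -, hmono, hper, hpol⟩ := hΓ.exists_strictMono_angle hC
  obtain ⟨ρ, hρ, hρc⟩ := hC.exists_lt_height hc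
  obtain ⟨D, hD, hoff⟩ := hC.exists_offset_bound
  refine ⟨ρ, hρ, 3 * D / ρ, by positivity, fun lam hlam => ⟨?_, fun θ hθ => ?_⟩⟩
  · obtain ⟨h1, h2⟩ := hC.measurable_ends hc hlam.1 fun θ => hlam.2.trans (hρc θ)
    refine (h2.sub (h1.max ((measurable_const (a := (0 : ℝ))).min h2))).aestronglyMeasurable.congr ?_
    filter_upwards [hC.ae_differentiableAt] with θ hθ
    exact (hΓ.length_rightSemiChord hC hc hmono hper hpol hθ hlam.1
      (hlam.2.trans (hρc θ))).symm
  · have hlc := hlam.2.trans (hρc θ)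
    have h0 := hlam.1
    have hDθ : ∀ a ∈ closure C, |offset C a θ| ≤ D := fun a ha => hoff a ha θ
    rw [hΓ.length_rightSemiChord hC hc hmono hper hpol hθ h0 hlc]
    have h1 := hC.rightEnd_le_reach (hC.isChord hc h0 hlc)
    have h2 := hC.reach_nonneg hθ h0.le
    have h3 := hC.reach_le_rightEnd_add hc hDθ h0 hlc
    have h4 := hC.leftEnd_le hc hθ hDθ h0 hlc
    have h5 : lam / height C c θ ≤ lam / ρ := div_le_div_of_nonneg_left h0.le hρ (hρc θ).le
    have h6 : lam / height C c θ * D ≤ lam / ρ * D := mul_le_mul_of_nonneg_right h5 hD.le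
    have h7 : 3 * D / ρ * lam = 3 * (lam / ρ * D) := by ring
    have h8 : 0 ≤ lam / ρ * D := by positivity
    constructor
    · rcases le_total 0 (rightEnd C θ lam) with h | h
      · have := le_max_right (leftEnd C θ lam) (min 0 (rightEnd C θ lam))
        rw [min_eq_left h] at this ⊢
        linarith
      · have := le_max_right (leftEnd C θ lam) (min 0 (rightEnd C θ lam))
        rw [min_eq_right h] at this ⊢
        linarith
    · have : max (leftEnd C θ lam) (min 0 (rightEnd C θ lam)) ≤ lam / ρ * D :=
        max_le (by linarith) ((min_le_left _ _).trans h8)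
      rw [h7]
      linarith

end PlanarConvex

end

/-! ### From the reach to the right semi-chord -/

theorem proposition3p3
    (C : Set PlanarConvex.Plane) (hconv : Convex ℝ C) (hbdd : Bornology.IsBounded C)
    (hint : (interior C).Nonempty)
    (L : ℝ) [Fact (0 < L)] (Γ : AddCircle L → PlanarConvex.Plane)
    (hΓ : PlanarConvex.IsBoundaryParam C Γ)
    (α β : ℝ) (hαβ : α < β) (hβ : β ≤ α + 2 * Real.pi) :
    (∀ᶠ lam : ℝ in 𝓝[>] 0, IntegrableOn
      (fun θ : ℝ => PlanarConvex.length
        (PlanarConvex.rightSemiChord C Γ (θ : Real.Angle) lam) ^ 2) (Ioc α β)) ∧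
    Tendsto
      (fun lam : ℝ => 1 / (2 * lam) *
        ∫ θ in Ioc α β, PlanarConvex.length
          (PlanarConvex.rightSemiChord C Γ (θ : Real.Angle) lam) ^ 2)
      (𝓝[>] 0)
      (𝓝 (PlanarConvex.perimeterPortion C Γ ((fun θ : ℝ => (θ : Real.Angle)) '' Ioc α β))) := by
  have hC : PlanarConvex.IsBody C := ⟨hconv, hbdd, hint⟩
  obtain ⟨ρ, hρ, K, hK, hbounds⟩ := hΓ.exists_length_bounds hC
  obtain ⟨D, hD, hoff⟩ := hC.exists_offset_bound
  have hlen : ∀ (lam θ : ℝ),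
      0 ≤ PlanarConvex.length (PlanarConvex.rightSemiChord C Γ (θ : Real.Angle) lam) :=
    fun _ _ => ENNReal.toReal_nonneg
  have hreach : ∀ lam θ : ℝ, 0 ≤ lam → PlanarConvex.reach C θ lam ≤ D := fun lam θ h =>
    hC.reach_le (fun a ha => hoff a ha θ) h
  have hint₁ : ∀ lam ∈ Ioo 0 ρ, IntegrableOn (fun θ : ℝ => PlanarConvex.length
      (PlanarConvex.rightSemiChord C Γ (θ : Real.Angle) lam) ^ 2) (Ioc α β) := by
    intro lam hlam
    refine Integrable.of_bound ((hbounds lam hlam).1.pow 2).restrict (D ^ 2) ?_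
    filter_upwards [ae_restrict_of_ae hC.ae_differentiableAt] with θ hθ
    rw [Real.norm_eq_abs, abs_of_nonneg (sq_nonneg _)]
    exact pow_le_pow_left₀ (hlen _ _)
      ((((hbounds lam hlam).2 θ hθ).1).trans (hreach lam θ hlam.1.le)) 2
  have hint₂ : ∀ lam ∈ Ioo 0 ρ,
      IntegrableOn (fun θ : ℝ => PlanarConvex.reach C θ lam ^ 2) (Ioc α β) := by
    intro lam hlam
    refine Integrable.of_bound ((hΓ.aestronglyMeasurable_reach hC hlam.1.le).pow 2).restrict
      (D ^ 2) ?_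
    filter_upwards [ae_restrict_of_ae hC.ae_differentiableAt] with θ hθ
    rw [Real.norm_eq_abs, abs_of_nonneg (sq_nonneg _)]
    exact pow_le_pow_left₀ (hC.reach_nonneg hθ hlam.1.le) (hreach lam θ hlam.1.le) 2
  have hsmall : ∀ᶠ lam : ℝ in 𝓝[>] 0, lam ∈ Ioo 0 ρ := Ioo_mem_nhdsGT hρ
  refine ⟨hsmall.mono hint₁, ?_⟩
  have hmain := hΓ.tendsto_integral_reach_sq hC hβ
  have hsqrt : Tendsto (fun lam : ℝ => √lam) (𝓝[>] 0) (𝓝 0) := by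
    have := (Real.continuous_sqrt.tendsto 0).mono_left (nhdsWithin_le_nhds (s := Ioi 0))
    rwa [Real.sqrt_zero] at this
  -- This lower bound comes from M² - ℓ² ≤ 2 K lam M, where ℓ is the semi-chord length. After
  -- division by 2 lam the error is K ∫ M, and M ≤ √lam + M² / √lam makes it O(√lam), since the
  -- normalized integral of M² converges.
  have hlow : Tendsto (fun lam : ℝ => 1 / (2 * lam) *
      (∫ θ in Ioc α β, PlanarConvex.reach C θ lam ^ 2) - K * √lam * ((β - α) + 2 *
        (1 / (2 * lam) * ∫ θ in Ioc α β, PlanarConvex.reach C θ lam ^ 2))) (𝓝[>] 0)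
      (𝓝 (PlanarConvex.perimeterPortion C Γ ((fun θ : ℝ => (θ : Real.Angle)) '' Ioc α β))) := by
    have := hmain.sub ((hsqrt.const_mul K).mul ((hmain.const_mul 2).const_add (β - α)))
    simpa using this
  refine tendsto_of_tendsto_of_tendsto_of_le_of_le' hlow hmain ?_ ?_
  · filter_upwards [hsmall] with lam hlam
    have h0 := hlam.1
    have hs0 : 0 < √lam := Real.sqrt_pos.2 h0
    have hss : √lam * √lam = lam := Real.mul_self_sqrt h0.le
    have hi : IntegrableOn (fun θ : ℝ => √lam + (√lam)⁻¹ * PlanarConvex.reach C θ lam ^ 2)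
        (Ioc α β) := (integrable_const _).add ((hint₂ lam hlam).const_mul _)
    have h1 : ∫ θ in Ioc α β, PlanarConvex.reach C θ lam ^ 2 ≤
        ∫ θ in Ioc α β, (PlanarConvex.length
          (PlanarConvex.rightSemiChord C Γ (θ : Real.Angle) lam) ^ 2 +
          2 * K * lam * (√lam + (√lam)⁻¹ * PlanarConvex.reach C θ lam ^ 2)) := by
      refine setIntegral_mono_ae_restrict (hint₂ lam hlam)
        ((hint₁ lam hlam).add (hi.const_mul _)) ?_
      filter_upwards [ae_restrict_of_ae hC.ae_differentiableAt] with θ hθ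
      obtain ⟨hb1, hb2⟩ := (hbounds lam hlam).2 θ hθ
      have hl0 := hlen lam θ
      set M := PlanarConvex.reach C θ lam with hM
      set ℓ := PlanarConvex.length (PlanarConvex.rightSemiChord C Γ (θ : Real.Angle) lam) with hℓ
      have hMs : M ≤ √lam + (√lam)⁻¹ * M ^ 2 := by
        rw [← mul_le_mul_iff_right₀ hs0, mul_add, mul_inv_cancel_left₀ hs0.ne']
        nlinarith [sq_nonneg (√lam - M), sq_nonneg (√lam + M)]
      have h2 : M ^ 2 ≤ ℓ ^ 2 + 2 * K * lam * M := by
        have : (M - ℓ) * (M + ℓ) ≤ (K * lam) * (2 * M) :=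
          mul_le_mul (by linarith) (by linarith) (by linarith) (by positivity)
        nlinarith
      have h3 : 2 * K * lam * M ≤ 2 * K * lam * (√lam + (√lam)⁻¹ * M ^ 2) :=
        mul_le_mul_of_nonneg_left hMs (by positivity)
      exact h2.trans (by linarith)
    rw [integral_add (hint₁ lam hlam) (hi.const_mul _), integral_const_mul,
      integral_add (integrable_const _) ((hint₂ lam hlam).const_mul _), integral_const_mul,
      setIntegral_const, Real.volume_real_Ioc_of_le hαβ.le, smul_eq_mul] at h1
    set M := ∫ θ in Ioc α β, PlanarConvex.reach C θ lam ^ 2 with hM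
    have h2 : 1 / (2 * lam) * (2 * K * lam * ((β - α) * √lam + (√lam)⁻¹ * M)) =
        K * √lam * ((β - α) + 2 * (1 / (2 * lam) * M)) := by
      have h4 : (√lam)⁻¹ = √lam / lam := by
        rw [eq_div_iff h0.ne', inv_mul_eq_iff_eq_mul₀ hs0.ne', hss]
      rw [h4]
      field_simp
    have h3 := mul_le_mul_of_nonneg_left h1 (by positivity : 0 ≤ 1 / (2 * lam))
    rw [mul_add, h2] at h3
    linarith
  · filter_upwards [hsmall] with lam hlam
    have h0 := hlam.1
    refine mul_le_mul_of_nonneg_left ?_ (by positivity)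
    refine setIntegral_mono_ae_restrict (hint₁ lam hlam) (hint₂ lam hlam) ?_
    filter_upwards [ae_restrict_of_ae hC.ae_differentiableAt] with θ hθ
    exact pow_le_pow_left₀ (hlen _ _) (((hbounds lam hlam).2 θ hθ).1) 2
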